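/- **Conventions.** Let $\pi(M)=(m_{11},m_{22},\det M)$ for $M=(m_{ij})\in M_2(\mathbb C)$, let $\overline{\mathbb E}=\{\pi(M):\|M\|\le 1\}\subset\mathbb C^3$ (operator norm) be the closed tetrablock and $b\mathbb E=\{\pi(U): U\text{ unitary}\}$. A commuting triple $(A,B,P)$ of bounded operators on a complex Hilbert space $\mathcal H$ is a *tetrablock contraction* if $\overline{\mathbb E}$ is a spectral set for it: its Taylor joint spectrum lies in $\overline{\mathbb E}$ and $\|f(A,B,P)\|\le\sup_{\overline{\mathbb E}}|f|$ for every rational function $f$ with poles off $\overline{\mathbb E}$. A *tetrablock unitary* is a commuting triple of normal operators with Taylor joint spectrum in $b\mathbb E$; a *tetrablock isometry* is the restriction of a tetrablock unitary to a joint invariant closed subspace. A triple $(V_1,V_2,V_3)$ on a Hilbert space $\mathcal K\supseteq\mathcal H$ is a *tetrablock isometric dilation* of $(A,B,P)$ if it is a tetrablock isometry and $V_1^*|_{\mathcal H}=A^*$, $V_2^*|_{\mathcal H}=B^*$, $V_3^*|_{\mathcal H}=P^*$. Put $D_P=(I-P^*P)^{1/2}$ and $\mathcal D_P=\overline{\operatorname{Ran}}\,D_P$.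 The *fundamental operators* of a tetrablock contraction $(A,B,P)$ are the (unique) $F_1,F_2\in\mathcal B(\mathcal D_P)$ with $$A-B^*P=D_PF_1D_P,\qquad B-A^*P=D_PF_2D_P .$$ For a Hilbert space $\mathcal E$, $L^\infty_{\mathbb T}(\mathcal B(\mathcal E))$ consists of the essentially bounded functions $\varphi:\mathbb T\to\mathcal B(\mathcal E)$ for which $z\mapsto\varphi(z)e$ is strongly measurable for every $e\in\mathcal E$; two of them are identified if $\varphi(z)e=\psi(z)e$ for almost every $z$, for each $e$ (for separable $\mathcal E$: if $\varphi=\psi$ almost everywhere). $T_\varphi$ is the compression of multiplication by $\varphi$ on $L^2_{\mathbb T}(\mathcal E)$ to the Hardy space $H^2(\mathcal E)$, which is identified with $\ell^2(\mathcal E)$ through $(e_n)_{n\ge0}\mapsto\sum_n e_nz^n$. Finally $[X,Y]=XY-YX$. **Theorem.** Let $(A,B,P)$ be a tetrablock contraction on a Hilbert space $\mathcal H$ with fundamental operators $F_1,F_2$. On $\mathcal K=\mathcal H\oplus\ell^2(\mathcal D_P)$ consider $$V_1=\begin{pmatrix}A&0\\C_1&T_{\varphi_1}\end{pmatrix},\quad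 V_2=\begin{pmatrix}B&0\\C_2&T_{\varphi_2}\end{pmatrix},\quad V_3=\begin{pmatrix}P&0\\C_3&T_{z^2}\end{pmatrix},$$ where $C_1,C_2:\mathcal H\to\ell^2(\mathcal D_P)$ are arbitrary bounded operators, $C_3=[\,0\;\;D_P\;\;0\;\;0\;\cdots]^t$, and $\varphi_1,\varphi_2\in L^\infty_{\mathbb T}(\mathcal B(\mathcal D_P))$ are arbitrary. Then $(V_1,V_2,V_3)$ is a tetrablock isometric dilation of $(A,B,P)$ if and only if there is $\Xi\in\mathcal B(\mathcal D_P)$ such that $$\varphi_1(z)=F_1+\Xi z+F_2^*z^2,\qquad \varphi_2(z)=F_2+\Xi^*z+F_1^*z^2$$ as elements of $L^\infty_{\mathbb T}(\mathcal B(\mathcal D_P))$ (so both symbols are analytic), $$C_1=[\,\Xi D_P\;\;F_2^*D_P\;\;0\;\;0\;\cdots]^t,\qquad C_2=[\,\Xi^*D_P\;\;F_1^*D_P\;\;0\;\;0\;\cdots]^t,$$ $$(\Xi F_1^*-\Xi^*F_2^*)D_PP=0,$$ $$[F_2,F_2^*]-[F_1,F_1^*]=[\Xi,\Xi^*],$$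 $$[F_1,F_2]=0,$$ $$[\Xi,F_2]=[\Xi^*,F_1],$$ $$\Xi D_PP=0\quad\text{and}\quad\Xi^*D_PP=0,$$ and $$\sup_{|z|=1}\|F_1+\Xi z+F_2^*z^2\|\le1 .$$ Moreover, for every $\Xi\in\mathcal B(\mathcal D_P)$ the last condition is equivalent to $\sup_{|z|=1}\|F_2+\Xi^*z+F_1^*z^2\|\le1$. -/

import Mathlib

open MeasureTheory ContinuousLinearMap
open scoped ENNReal InnerProduct

noncomputable section

namespace Tetrablock

universe u

/-! ### The closed tetrablock and its distinguished boundary -/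

/-- The map `π : M₂(ℂ) → ℂ³`, `π(A) = (a₁₁, a₂₂, det A)`. -/
def piMap (M : Matrix (Fin 2) (Fin 2) ℂ) : Fin 3 → ℂ := ![M 0 0, M 1 1, M.det]

/-- The closed tetrablock: all `π(A)` with `A` a contraction for the (Euclidean) operator norm. -/
def closedTetrablock : Set (Fin 3 → ℂ) :=
  piMap '' {M | ‖Matrix.toEuclideanCLM (𝕜 := ℂ) M‖ ≤ 1}

/-- The distinguished boundary of the tetrablock: all `π(U)` with `U` unitary. -/
def distinguishedBoundary : Set (Fin 3 → ℂ) :=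
  piMap '' {M | M ∈ Matrix.unitaryGroup (Fin 2) ℂ}

section Operators

variable {H : Type u} [NormedAddCommGroup H] [InnerProductSpace ℂ H]

/-! ### The Taylor joint spectrum of a triple of operators -/

/-- The three operators commute pairwise. -/
def CommutingTriple (T : Fin 3 → H →L[ℂ] H) : Prop := ∀ i j, T i * T j = T j * T i

/-- First map `H → H³` of the Koszul complex. -/
def koszul0 (T : Fin 3 → H →L[ℂ] H) (x : H) : H × H × H := (T 0 x, T 1 x, T 2 x)

/-- Second map `H³ → H³` of the Koszul complex; the target has coordinates `01, 02, 12`. -/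
def koszul1 (T : Fin 3 → H →L[ℂ] H) (x : H × H × H) : H × H × H :=
  (T 0 x.2.1 - T 1 x.1, T 0 x.2.2 - T 2 x.1, T 1 x.2.2 - T 2 x.2.1)

/-- Third map `H³ → H` of the Koszul complex. -/
def koszul2 (T : Fin 3 → H →L[ℂ] H) (y : H × H × H) : H :=
  T 0 y.2.2 - T 1 y.2.1 + T 2 y.1

/-- The Koszul complex `0 → H → H³ → H³ → H → 0` of the triple is exact. -/
def KoszulExact (T : Fin 3 → H →L[ℂ] H) : Prop :=
  (∀ x, koszul0 T x = 0 → x = 0) ∧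
  (∀ x, koszul1 T x = 0 → ∃ w, koszul0 T w = x) ∧
  (∀ y, koszul2 T y = 0 → ∃ x, koszul1 T x = y) ∧
  (∀ v, ∃ y, koszul2 T y = v)

/-- The Taylor joint spectrum of a commuting triple: those `z ∈ ℂ³` for which the Koszul complex
of `(T₁ - z₁, T₂ - z₂, T₃ - z₃)` is not exact. -/
def taylorSpectrum (T : Fin 3 → H →L[ℂ] H) : Set (Fin 3 → ℂ) :=
  {z | ¬ KoszulExact (fun i => T i - z i • (1 : H →L[ℂ] H))}

/-! ### Tetrablock contractions, unitaries and isometries -/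

/-- The polynomial `p(T₁, T₂, T₃)` in three (commuting) operators. -/
def polyEval (T : Fin 3 → H →L[ℂ] H) (p : MvPolynomial (Fin 3) ℂ) : H →L[ℂ] H :=
  ∑ m ∈ p.support, p.coeff m • (T 0 ^ m 0 * T 1 ^ m 1 * T 2 ^ m 2)

/-- A compact set `K ⊆ ℂ³` is a spectral set for the commuting triple `T`: the Taylor joint spectrum
lies in `K`, and `‖f(T)‖ ≤ sup_K |f|` for all rational functions `f = p / q` with poles off `K`.
For these `f(T) = p(T) q(T)⁻¹`; here `q(T)` is invertible since `q` has no zero on the Taylor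
spectrum. -/
def IsSpectralSet (K : Set (Fin 3 → ℂ)) (T : Fin 3 → H →L[ℂ] H) : Prop :=
  CommutingTriple T ∧ taylorSpectrum T ⊆ K ∧
    ∀ p q : MvPolynomial (Fin 3) ℂ, (∀ z ∈ K, MvPolynomial.eval z q ≠ 0) →
      ‖polyEval T p * Ring.inverse (polyEval T q)‖ₑ ≤
        ⨆ z ∈ K, ‖MvPolynomial.eval z p / MvPolynomial.eval z q‖ₑ

/-- `(A, B, P)` is a tetrablock contraction. -/
def IsTetrablockContraction (A B P : H →L[ℂ] H) : Prop :=
  IsSpectralSet closedTetrablock ![A, B, P]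

/-- A tetrablock unitary: commuting normal operators with joint spectrum in the distinguished
boundary. -/
def IsTetrablockUnitary [CompleteSpace H] (N : Fin 3 → H →L[ℂ] H) : Prop :=
  CommutingTriple N ∧ (∀ i, IsStarNormal (N i)) ∧ taylorSpectrum N ⊆ distinguishedBoundary

/-- A tetrablock isometry: the restriction of a tetrablock unitary to a joint invariant closed
subspace (the range of the isometric embedding `ι`). -/
def IsTetrablockIsometry (V : Fin 3 → H →L[ℂ] H) : Prop :=
  ∃ (L : Type u) (_ : NormedAddCommGroup L) (_ : InnerProductSpace ℂ L) (_ : CompleteSpace L)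
    (N : Fin 3 → L →L[ℂ] L) (ι : H →ₗᵢ[ℂ] L),
    IsTetrablockUnitary N ∧ ∀ i x, N i (ι x) = ι (V i x)

/-- `(V₁, V₂, V₃)` on `K`, which contains `H` through the isometric embedding `j`, is a tetrablock
isometric dilation of `(A, B, P)`: it is a tetrablock isometry, and
`V₁*|_H = A*`, `V₂*|_H = B*`, `V₃*|_H = P*`. -/
def IsTetrablockIsometricDilation {K : Type u} [NormedAddCommGroup K] [InnerProductSpace ℂ K]
    [CompleteSpace H] [CompleteSpace K] (j : H →ₗᵢ[ℂ] K)
    (A B P : H →L[ℂ] H) (V₁ V₂ V₃ : K →L[ℂ] K) : Prop :=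
  IsTetrablockIsometry ![V₁, V₂, V₃] ∧
    ∀ x, adjoint V₁ (j x) = j (adjoint A x) ∧ adjoint V₂ (j x) = j (adjoint B x) ∧
      adjoint V₃ (j x) = j (adjoint P x)

/-! ### Defect operator and fundamental operators -/

variable [CompleteSpace H]

/-- The defect operator `D_P = (I - P*P)^{1/2}` (meaningful for contractions `P`). -/
def defectOp (P : H →L[ℂ] H) : H →L[ℂ] H := CFC.sqrt (1 - P† * P)

/-- The defect space `𝒟_P`, the closure of the range of `D_P`. -/
abbrev defectSpace (P : H →L[ℂ] H) : Submodule ℂ H := (defectOp P).range.topologicalClosure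

/-- `D_P` as an operator from `H` into `𝒟_P`. -/
def defectTo (P : H →L[ℂ] H) : H →L[ℂ] defectSpace P :=
  (defectOp P).codRestrict (defectSpace P)
    (fun x => Submodule.le_topologicalClosure _ (LinearMap.mem_range_self _ x))

/-- `F₁, F₂ ∈ B(𝒟_P)` are the fundamental operators of `(A, B, P)`:
`A - B*P = D_P F₁ D_P` and `B - A*P = D_P F₂ D_P`. -/
def IsFundamentalPair (A B P : H →L[ℂ] H) (F₁ F₂ : defectSpace P →L[ℂ] defectSpace P) : Prop :=
  (∀ x, A x - (B† * P) x = defectOp P (F₁ (defectTo P x) : H)) ∧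
  (∀ x, B x - (A† * P) x = defectOp P (F₂ (defectTo P x) : H))

end Operators

/-! ### The circle, symbols and Toeplitz operators

The circle `𝕋` is parametrised by `t ∈ ℝ/ℤ` through `z = e^{2πit} = fourier 1 t`, and carries the
normalised Haar (arc length) measure. -/

/-- Normalised arc length measure. -/
abbrev arc : Measure UnitAddCircle := AddCircle.haarAddCircle

section Toeplitz

variable (E : Type u) [NormedAddCommGroup E] [InnerProductSpace ℂ E]

/-- `ℓ²(E)`. -/
abbrev Ell2 : Type u := lp (fun _ : ℕ => E) 2

/-- `L²_𝕋(E)`. -/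
abbrev L2Circle : Type u := Lp E 2 arc

/-- Functions representing elements of `L^∞_𝕋(B(E))`: essentially bounded and measurable in the
strong operator topology. -/
structure LInfSymbol where
  toFun : UnitAddCircle → E →L[ℂ] E
  meas : ∀ e, AEStronglyMeasurable (fun t => toFun t e) arc
  bdd : ∃ C : ℝ, ∀ᵐ t ∂arc, ‖toFun t‖ ≤ C

variable {E}

/-- The symbol `φ` equals `ψ(z)` as an element of `L^∞_𝕋(B(E))`: for every vector `e`,
`φ(z)e = ψ(z)e` almost everywhere. (For separable `E` this says `φ = ψ` almost everywhere.) -/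
def LInfSymbol.Represents (φ : LInfSymbol E) (ψ : ℂ → E →L[ℂ] E) : Prop :=
  ∀ e, ∀ᵐ t ∂arc, φ.toFun t e = ψ (fourier 1 t) e

/-- `‖ψ‖_∞ = sup_{|z| = 1} ‖ψ(z)‖`. -/
def circleSup (ψ : ℂ → E →L[ℂ] E) : ℝ≥0∞ := ⨆ z ∈ Metric.sphere (0 : ℂ) 1, ‖ψ z‖ₑ

/-- The operator polynomial `z ↦ a + b z + c z²`. -/
def quadPoly (a b c : E →L[ℂ] E) (z : ℂ) : E →L[ℂ] E := a + z • b + z ^ 2 • c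

/-- The symbol of a continuous function of `z`. -/
def LInfSymbol.ofContinuous (ψ : ℂ → E →L[ℂ] E) (hψ : Continuous ψ) : LInfSymbol E where
  toFun t := ψ (fourier 1 t)
  meas e := by
    have h : Continuous fun t : UnitAddCircle => ψ (fourier 1 t) e :=
      (hψ.comp (fourier 1).continuous).clm_apply continuous_const
    exact h.aestronglyMeasurable_of_compactSpace
  bdd := by
    have h : Continuous fun t : UnitAddCircle => ‖ψ (fourier 1 t)‖ :=
      (hψ.comp (fourier 1).continuous).norm
    obtain ⟨C, hC⟩ := (isCompact_range h).bddAbove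
    exact ⟨C, Filter.Eventually.of_forall fun t => hC ⟨t, rfl⟩⟩

/-- The symbol `z²`. -/
def zSq : LInfSymbol E :=
  LInfSymbol.ofContinuous (fun z => z ^ 2 • (1 : E →L[ℂ] E)) (by fun_prop)

theorem LInfSymbol.aestronglyMeasurable_apply (φ : LInfSymbol E) {f : UnitAddCircle → E}
    (hf : AEStronglyMeasurable f arc) :
    AEStronglyMeasurable (fun t => φ.toFun t (f t)) arc := by
  obtain ⟨g, hg, hfg⟩ := hf
  have key : ∀ s : SimpleFunc UnitAddCircle E,
      AEStronglyMeasurable (fun t => φ.toFun t (s t)) arc := by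
    intro s
    have h : (fun t => φ.toFun t (s t)) =
        fun t => ∑ c ∈ s.range, (s ⁻¹' {c}).indicator (fun t => φ.toFun t c) t := by
      funext t
      rw [Finset.sum_eq_single (s t)]
      · simp
      · intro c _ hc
        exact Set.indicator_of_notMem (fun h => hc h.symm) _
      · intro h
        exact absurd (SimpleFunc.mem_range_self s t) h
    rw [h]
    exact Finset.aestronglyMeasurable_fun_sum _
      fun c _ => (φ.meas c).indicator (s.measurableSet_fiber c)
  have hlim : AEStronglyMeasurable (fun t => φ.toFun t (g t)) arc :=
    aestronglyMeasurable_of_tendsto_ae Filter.atTop (fun n => key (hg.approx n))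
      (Filter.Eventually.of_forall fun t =>
        ((φ.toFun t).continuous.tendsto _).comp (hg.tendsto_approx t))
  refine hlim.congr ?_
  filter_upwards [hfg] with t ht
  rw [ht]

theorem LInfSymbol.memLp_apply (φ : LInfSymbol E) (f : L2Circle E) :
    MemLp (fun t => φ.toFun t (f t)) 2 arc := by
  obtain ⟨C, hC⟩ := φ.bdd
  refine (Lp.memLp f).of_le_mul (c := C) (φ.aestronglyMeasurable_apply (Lp.aestronglyMeasurable f)) ?_
  filter_upwards [hC] with t ht
  exact (φ.toFun t).le_of_opNorm_le ht _

/-- The multiplication operator `(M_φ f)(z) = φ(z) f(z)` on `L²_𝕋(E)`. -/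
def mulOp (φ : LInfSymbol E) : L2Circle E →L[ℂ] L2Circle E :=
  LinearMap.mkContinuousOfExistsBound
    { toFun := fun f => (φ.memLp_apply f).toLp _
      map_add' := fun f g => by
        rw [← MemLp.toLp_add]
        apply MemLp.toLp_congr
        filter_upwards [Lp.coeFn_add f g] with t ht
        rw [ht, Pi.add_apply, map_add, Pi.add_apply]
      map_smul' := fun c f => by
        rw [RingHom.id_apply, ← MemLp.toLp_const_smul]
        apply MemLp.toLp_congr
        filter_upwards [Lp.coeFn_smul c f] with t ht
        rw [ht, Pi.smul_apply, map_smul, Pi.smul_apply] }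
    (by
      obtain ⟨C, hC⟩ := φ.bdd
      refine ⟨C, fun f => Lp.norm_le_mul_norm_of_ae_le_mul ?_⟩
      filter_upwards [hC, (φ.memLp_apply f).coeFn_toLp] with t ht h
      simp only [LinearMap.coe_mk, AddHom.coe_mk]
      rw [h]
      exact (φ.toFun t).le_of_opNorm_le ht _)

theorem norm_fourier_apply (n : ℤ) (t : UnitAddCircle) : ‖(fourier n t : ℂ)‖ = 1 :=
  Circle.norm_coe _

theorem memLp_monomial (n : ℕ) (e : E) :
    MemLp (fun t : UnitAddCircle => (fourier (n : ℤ) t : ℂ) • e) 2 arc :=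
  MemLp.of_bound
    (((fourier (n : ℤ)).continuous.smul continuous_const).aestronglyMeasurable_of_compactSpace) ‖e‖
    (Filter.Eventually.of_forall fun t => by rw [norm_smul, norm_fourier_apply, one_mul])

/-- The embedding `e ↦ zⁿ e` of `E` into `L²_𝕋(E)`. -/
def monomial (n : ℕ) : E →ₗᵢ[ℂ] L2Circle E where
  toFun e := (memLp_monomial n e).toLp _
  map_add' e e' := by
    rw [← MemLp.toLp_add]
    apply MemLp.toLp_congr
    exact Filter.Eventually.of_forall fun t => by simp
  map_smul' c e := by
    rw [RingHom.id_apply, ← MemLp.toLp_const_smul]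
    apply MemLp.toLp_congr
    exact Filter.Eventually.of_forall fun t => smul_comm _ _ _
  norm_map' e := by
    simp only [LinearMap.coe_mk, AddHom.coe_mk]
    rw [Lp.norm_toLp, eLpNorm_congr_norm_ae (g := fun _ => e)
      (Filter.Eventually.of_forall fun t => by rw [norm_smul, norm_fourier_apply, one_mul]),
      eLpNorm_const _ two_ne_zero (IsProbabilityMeasure.ne_zero _)]
    simp

theorem orthogonalFamily_monomial :
    OrthogonalFamily ℂ (fun _ : ℕ => E) (fun n : ℕ => monomial (E := E) n) := by
  intro m n hmn x y
  have h0 := orthonormal_iff_ite.mp (orthonormal_fourier (T := 1)) (m : ℤ) (n : ℤ)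
  rw [if_neg (by exact_mod_cast hmn), ContinuousMap.inner_toLp] at h0
  rw [L2.inner_def]
  have h1 : (fun t => inner ℂ (monomial (E := E) m x t) (monomial (E := E) n y t)) =ᵐ[arc]
      fun t => (fourier (n : ℤ) t * (starRingEnd ℂ) (fourier (m : ℤ) t)) * inner ℂ x y := by
    filter_upwards [(memLp_monomial m x).coeFn_toLp, (memLp_monomial n y).coeFn_toLp] with t h h'
    change inner ℂ ((memLp_monomial m x).toLp _ t) ((memLp_monomial n y).toLp _ t) = _
    rw [h, h', inner_smul_left, inner_smul_right]
    ring
  rw [integral_congr_ae h1, integral_mul_const, h0, zero_mul]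

variable [CompleteSpace E]

/-- The identification of `ℓ²(E)` with the Hardy space `H²(E) ⊆ L²_𝕋(E)`:
`(e₀, e₁, …) ↦ ∑ zⁿ eₙ`. -/
def hardyEmb : Ell2 E →ₗᵢ[ℂ] L2Circle E := orthogonalFamily_monomial.linearIsometry

/-- The Toeplitz operator `T_φ`, the compression of `M_φ` to the Hardy space, as an operator on
`ℓ²(E)`. -/
def toeplitz (φ : LInfSymbol E) : Ell2 E →L[ℂ] Ell2 E :=
  adjoint hardyEmb.toContinuousLinearMap ∘L mulOp φ ∘L hardyEmb.toContinuousLinearMap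

end Toeplitz

/-! ### Block operators on `H ⊕ ℓ²(E)` -/

section Block

variable {H G E : Type u} [NormedAddCommGroup H] [InnerProductSpace ℂ H]
  [NormedAddCommGroup G] [InnerProductSpace ℂ G]
  [NormedAddCommGroup E] [InnerProductSpace ℂ E]

/-- The embedding `h ↦ (h, 0)` of `H` into `H ⊕ G`. -/
def inlIsometry : H →ₗᵢ[ℂ] WithLp 2 (H × G) where
  toFun h := WithLp.toLp 2 (h, 0)
  map_add' h h' := by
    rw [← WithLp.toLp_add]; simp
  map_smul' c h := by
    rw [RingHom.id_apply, ← WithLp.toLp_smul]; simp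
  norm_map' h := by simp

/-- The lower triangular block operator `(h, x) ↦ (A h, C h + T x)` on `H ⊕ G`. -/
def lowerTri (A : H →L[ℂ] H) (C : H →L[ℂ] G) (T : G →L[ℂ] G) :
    WithLp 2 (H × G) →L[ℂ] WithLp 2 (H × G) :=
  (WithLp.prodContinuousLinearEquiv 2 ℂ H G).symm.toContinuousLinearMap ∘L
    ((A ∘L WithLp.fstL 2 ℂ H G).prod (C ∘L WithLp.fstL 2 ℂ H G + T ∘L WithLp.sndL 2 ℂ H G))

/-- The column `[X Y 0 0 ⋯]ᵗ : H → ℓ²(E)`. -/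
def column (X Y : H →L[ℂ] E) : H →L[ℂ] Ell2 E :=
  lp.singleContinuousLinearMap ℂ (fun _ : ℕ => E) 2 0 ∘L X +
    lp.singleContinuousLinearMap ℂ (fun _ : ℕ => E) 2 1 ∘L Y

end Block

end Tetrablock

end

noncomputable section

namespace Tetrablock

universe u

open scoped ComplexConjugate

/-! Everything rests on an algebraic criterion: a triple is a tetrablock isometry exactly when it
commutes, `V₃` is isometric, `V₁ = V₂* V₃` and `‖V₂‖ ≤ 1` (`IsTetrablockIsometry.relations`,
`isTetrablockIsometry_of_relations`). For unitaries the relations are the equations of the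
distinguished boundary, transferred by Gelfand theory; for isometries they pass to invariant
subspaces, and conversely extend to a unitary extension of `V₃`.

For block triples the adjoint conditions of a dilation are automatic, so the criterion becomes block
algebra. Necessity: a Toeplitz operator commuting with `T_{z²}` is lower triangular, and `T₁ = T₂*
T_{z²}` then leaves three diagonals (`exists_eq_quadToeplitz`). The other blocks of `V₁ = V₂* V₃`
and `V₂ = V₁* V₃` give the columns and, by uniqueness of the fundamental operators, the outer
coefficients; commutation gives the equations for `Ξ`, with the help of `D A = F₁ D + F₂* D P`
(`defect_comp_eq`).

Sufficiency reverses the algebra, except that the supremum condition bounds only the Toeplitz corner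
of `V₂`, not `V₂` itself. The relations make `V₂` hyponormal, the block form makes its powers grow
at most linearly, and together these force `‖V₂‖ ≤ 1` (`norm_le_one_of_linear_growth`). -/

/-! ### Equations of the distinguished boundary -/

theorem mem_distinguishedBoundary_iff {z : Fin 3 → ℂ} :
    z ∈ distinguishedBoundary ↔ z 0 = conj (z 1) * z 2 ∧ ‖z 2‖ = 1 ∧ ‖z 1‖ ≤ 1 := by
  constructor
  · rintro ⟨U, hU, rfl⟩
    rw [Set.mem_ofPred_eq, Matrix.mem_unitaryGroup_iff] at hU
    have h (i j) := congrFun (congrFun hU i) j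
    have h00 := h 0 0
    have h01 := h 0 1
    have h11 := h 1 1
    simp only [Matrix.mul_apply, Fin.sum_univ_two, Matrix.star_apply, Matrix.one_apply_eq,
      RCLike.star_def] at h00 h11
    simp only [Matrix.mul_apply, Fin.sum_univ_two, Matrix.star_apply, RCLike.star_def,
      Matrix.one_apply_ne (show (0 : Fin 2) ≠ 1 by decide)] at h01
    have hd := Matrix.det_fin_two U
    refine ⟨?_, ?_, ?_⟩
    · simp only [piMap, Matrix.cons_val]
      rw [hd]
      linear_combination (U 0 0) * (-h11) + (U 1 0) * h01
    · simp only [piMap, Matrix.cons_val]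
      have h1 : U.det * conj U.det = 1 := by
        rw [hd, map_sub, map_mul, map_mul]
        linear_combination (U 1 0 * conj (U 1 0) + U 1 1 * conj (U 1 1)) * h00 + h11 -
          (U 1 0 * conj (U 0 0) + U 1 1 * conj (U 0 1)) * h01
      rw [Complex.mul_conj] at h1
      have h2 : Complex.normSq U.det = 1 := by exact_mod_cast h1
      rw [Complex.normSq_eq_norm_sq] at h2
      nlinarith [norm_nonneg U.det]
    · simp only [piMap, Matrix.cons_val]
      rw [Complex.mul_conj, Complex.mul_conj] at h11
      have h2 : Complex.normSq (U 1 0) + Complex.normSq (U 1 1) = 1 := by exact_mod_cast h11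
      rw [Complex.normSq_eq_norm_sq, Complex.normSq_eq_norm_sq] at h2
      nlinarith [norm_nonneg (U 1 1), sq_nonneg ‖U 1 0‖]
  · rintro ⟨h0, h2, h1⟩
    set s : ℝ := Real.sqrt (1 - ‖z 1‖ ^ 2) with hs
    have hs2 : (s : ℂ) * s = 1 - z 1 * conj (z 1) := by
      rw [Complex.mul_conj, Complex.normSq_eq_norm_sq]
      have : s * s = 1 - ‖z 1‖ ^ 2 := Real.mul_self_sqrt (by nlinarith [norm_nonneg (z 1)])
      exact_mod_cast this
    have h3 : z 2 * conj (z 2) = 1 := by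
      rw [Complex.mul_conj, Complex.normSq_eq_norm_sq, h2]; simp
    -- The second row is a unit vector with last entry `z 1`; the first row is the orthogonal unit
    -- vector whose phase makes the determinant `z 2`.
    refine ⟨!![conj (z 1) * z 2, s * z 2; -s, z 1], ?_, ?_⟩
    · rw [Set.mem_ofPred_eq, Matrix.mem_unitaryGroup_iff]
      ext i j
      fin_cases i <;> fin_cases j <;>
        simp [Matrix.mul_apply, Fin.sum_univ_two, Matrix.star_apply]
      · linear_combination (z 2 * conj (z 2)) * hs2 + h3
      · ring
      · ring
      · linear_combination hs2
    · ext i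
      fin_cases i
      · simp [piMap, h0]
      · simp [piMap]
      · simp [piMap, Matrix.det_fin_two]
        linear_combination (z 2) * hs2

/-! ### Exactness of the Koszul complex -/

section Operators

variable {H : Type u} [NormedAddCommGroup H] [InnerProductSpace ℂ H] [CompleteSpace H]

theorem isUnit_sum_of_bounded_below (T : Fin 3 → H →L[ℂ] H) {c : ℝ} (hc : 0 < c)
    (h : ∀ x, c * ‖x‖ ^ 2 ≤ ‖T 0 x‖ ^ 2 + ‖T 1 x‖ ^ 2 + ‖T 2 x‖ ^ 2) :
    IsUnit (star (T 0) * T 0 + star (T 1) * T 1 + star (T 2) * T 2) := by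
  refine ContinuousLinearMap.isUnit_of_forall_le_norm_inner_map _ (c := ⟨c, hc.le⟩) hc fun x => ?_
  have : inner ℂ ((star (T 0) * T 0 + star (T 1) * T 1 + star (T 2) * T 2) x) x =
      ((‖T 0 x‖ ^ 2 + ‖T 1 x‖ ^ 2 + ‖T 2 x‖ ^ 2 : ℝ) : ℂ) := by
    simp [star_eq_adjoint, adjoint_inner_left, inner_self_eq_norm_sq_to_K]
  rw [this, Complex.norm_real, Real.norm_of_nonneg (by positivity), mul_comm]
  exact h x

/-- By the open mapping theorem `x` has a preimage `y` with `‖y‖ ≤ C ‖x‖`; expanding `⟪x, koszul2 T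
y⟫ = ‖x‖²` moves the operators to adjoints acting on `x`. The 3 in the constant comes from `(a + b +
d)² ≤ 3 (a² + b² + d²)`. -/
theorem exists_bounded_below_of_koszul2_surjective (T : Fin 3 → H →L[ℂ] H)
    (h : ∀ v, ∃ y, koszul2 T y = v) :
    ∃ c : ℝ, 0 < c ∧ ∀ x, c * ‖x‖ ^ 2 ≤
      ‖star (T 0) x‖ ^ 2 + ‖star (T 1) x‖ ^ 2 + ‖star (T 2) x‖ ^ 2 := by
  let R : H × H × H →L[ℂ] H :=
    T 0 ∘L (snd ℂ H H ∘L snd ℂ H (H × H)) - T 1 ∘L (fst ℂ H H ∘L snd ℂ H (H × H)) +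
      T 2 ∘L fst ℂ H (H × H)
  have hR : ∀ y, R y = koszul2 T y := fun y => by simp [R, koszul2]
  obtain ⟨C, hC, hpre⟩ := R.exists_preimage_norm_le (fun v => by simpa only [hR] using h v)
  refine ⟨(3 * C ^ 2)⁻¹, by positivity, fun x => ?_⟩
  obtain ⟨y, hy, hyx⟩ := hpre x
  have h1 : ‖y.1‖ ≤ C * ‖x‖ := (norm_fst_le y).trans hyx
  have h2 : ‖y.2.1‖ ≤ C * ‖x‖ := ((norm_fst_le y.2).trans (norm_snd_le y)).trans hyx
  have h3 : ‖y.2.2‖ ≤ C * ‖x‖ := ((norm_snd_le y.2).trans (norm_snd_le y)).trans hyx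
  have key : ((‖x‖ ^ 2 : ℝ) : ℂ) = inner ℂ (star (T 0) x) y.2.2 - inner ℂ (star (T 1) x) y.2.1 +
      inner ℂ (star (T 2) x) y.1 := by
    have : inner ℂ x (koszul2 T y) = inner ℂ x x := by rw [← hR, hy]
    rw [inner_self_eq_norm_sq_to_K, koszul2, inner_add_right, inner_sub_right] at this
    simp only [star_eq_adjoint, adjoint_inner_left]
    rw [this]; simp
  have hn : ‖x‖ ^ 2 ≤ (‖star (T 0) x‖ + ‖star (T 1) x‖ + ‖star (T 2) x‖) * (C * ‖x‖) := by
    have h4 : ‖x‖ ^ 2 = ‖((‖x‖ ^ 2 : ℝ) : ℂ)‖ := by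
      rw [Complex.norm_real, Real.norm_of_nonneg (by positivity)]
    rw [h4, key]
    calc _ ≤ ‖inner ℂ (star (T 0) x) y.2.2‖ + ‖inner ℂ (star (T 1) x) y.2.1‖
          + ‖inner ℂ (star (T 2) x) y.1‖ := (norm_add_le _ _).trans (by gcongr; exact norm_sub_le _ _)
      _ ≤ ‖star (T 0) x‖ * ‖y.2.2‖ + ‖star (T 1) x‖ * ‖y.2.1‖ + ‖star (T 2) x‖ * ‖y.1‖ := by
        gcongr <;> exact norm_inner_le_norm _ _
      _ ≤ ‖star (T 0) x‖ * (C * ‖x‖) + ‖star (T 1) x‖ * (C * ‖x‖)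
          + ‖star (T 2) x‖ * (C * ‖x‖) := by gcongr
      _ = _ := by ring
  rw [inv_mul_le_iff₀ (by positivity)]
  set a := ‖star (T 0) x‖
  set b := ‖star (T 1) x‖
  set d := ‖star (T 2) x‖
  have hn' : ‖x‖ ≤ C * (a + b + d) := by
    rcases (norm_nonneg x).eq_or_lt with h0 | h0
    · rw [← h0]; positivity
    · have : ‖x‖ * ‖x‖ ≤ (C * (a + b + d)) * ‖x‖ := by linarith
      exact le_of_mul_le_mul_right this h0
  calc ‖x‖ ^ 2 ≤ (C * (a + b + d)) ^ 2 := by gcongr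
    _ = C ^ 2 * (a + b + d) ^ 2 := by ring
    _ ≤ C ^ 2 * (3 * (a ^ 2 + b ^ 2 + d ^ 2)) := by
      gcongr
      nlinarith [sq_nonneg (a - b), sq_nonneg (b - d), sq_nonneg (a - d)]
    _ = _ := by ring

-- Contraction with `R` is a homotopy from the identity of the Koszul complex to zero, because the
-- `R i` commute with the `T j`.
omit [CompleteSpace H] in
theorem koszulExact_of_left_inverse {T R : Fin 3 → H →L[ℂ] H}
    (hRT : ∀ i j, R i * T j = T j * R i)
    (h1 : R 0 * T 0 + R 1 * T 1 + R 2 * T 2 = 1) : KoszulExact T := by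
  have hRT' (i j) (x : H) : R i (T j x) = T j (R i x) := congrArg (· x) (hRT i j)
  have h1' (x : H) : R 0 (T 0 x) + R 1 (T 1 x) + R 2 (T 2 x) = x := congrArg (· x) h1
  refine ⟨fun x hx => ?_, fun x hx => ?_, fun y hy => ?_, fun v => ?_⟩
  · simp only [koszul0, Prod.mk_eq_zero] at hx
    rw [← h1' x, hx.1, hx.2.1, hx.2.2]; simp
  · obtain ⟨a, b, c⟩ := x
    simp only [koszul1, Prod.mk_eq_zero, sub_eq_zero] at hx
    obtain ⟨e1, e2, e3⟩ := hx
    refine ⟨R 0 a + R 1 b + R 2 c, ?_⟩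
    simp only [koszul0, map_add, ← hRT', Prod.mk.injEq]
    refine ⟨?_, ?_, ?_⟩
    · rw [e1, e2, h1' a]
    · rw [← e1, e3, h1' b]
    · rw [← e2, ← e3, h1' c]
  · obtain ⟨a, b, c⟩ := y
    simp only [koszul2] at hy
    have hy' : ∀ i, T 2 (R i a) = T 1 (R i b) - T 0 (R i c) := fun i => by
      have := congrArg (R i) hy
      simp only [map_add, map_sub, hRT', map_zero] at this
      rw [← sub_eq_zero, ← this]; abel
    -- This is the contraction of the 2-form with coordinates `01, 02, 12` by `R`.
    refine ⟨(-(R 1 a) - R 2 b, R 0 a - R 2 c, R 0 b + R 1 c), ?_⟩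
    simp only [koszul1, map_add, map_sub, map_neg, Prod.mk.injEq]
    have ha := h1' a
    have hb := h1' b
    have hc := h1' c
    simp only [hRT'] at ha hb hc
    have y0 := hy' 0
    have y1 := hy' 1
    have y2 := hy' 2
    refine ⟨?_, ?_, ?_⟩
    · refine Eq.trans ?_ ha; rw [y2]; abel
    · refine Eq.trans ?_ hb; rw [y1]; abel
    · refine Eq.trans ?_ hc; rw [y0]; abel
  · refine ⟨(R 2 v, -(R 1 v), R 0 v), ?_⟩
    simp only [koszul2, map_neg, sub_neg_eq_add, ← hRT']
    exact h1' v

end Operators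

/-- In a commutative C⋆-algebra, the relations defining the distinguished boundary hold for a triple
as soon as they hold under every character. -/
theorem relations_of_forall_character {S : Type*} [CommCStarAlgebra S] (n : Fin 3 → S)
    (hchar : ∀ χ : WeakDual.characterSpace ℂ S,
      χ (n 0) = conj (χ (n 1)) * χ (n 2) ∧ ‖χ (n 2)‖ = 1 ∧ ‖χ (n 1)‖ ≤ 1) :
    star (n 2) * n 2 = 1 ∧ n 0 = star (n 1) * n 2 ∧ ‖n 1‖ ≤ 1 := by
  have hinj : Function.Injective (WeakDual.gelfandTransform ℂ S) :=
    (gelfandTransform_isometry S).injective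
  have hstar (χ : WeakDual.characterSpace ℂ S) (a : S) : χ (star a) = conj (χ a) := map_star χ a
  refine ⟨hinj ?_, hinj ?_, ?_⟩
  · ext χ
    rw [map_mul, map_one, ContinuousMap.mul_apply, ContinuousMap.one_apply,
      WeakDual.gelfandTransform_apply_apply, WeakDual.gelfandTransform_apply_apply, hstar,
      mul_comm, Complex.mul_conj, Complex.normSq_eq_norm_sq, (hchar χ).2.1]
    simp
  · ext χ
    rw [map_mul, ContinuousMap.mul_apply, WeakDual.gelfandTransform_apply_apply,
      WeakDual.gelfandTransform_apply_apply, WeakDual.gelfandTransform_apply_apply, hstar]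
    exact (hchar χ).1
  · rw [← (gelfandTransform_isometry S).norm_map_of_map_zero (map_zero _)]
    exact (ContinuousMap.norm_le _ zero_le_one).mpr fun χ => (hchar χ).2.2

/-! ### Tetrablock unitaries in terms of operator relations -/

section Operators

variable {H : Type u} [NormedAddCommGroup H] [InnerProductSpace ℂ H] [CompleteSpace H]

/-- Commuting with `U` is commuting with `U⁻¹ = star U`; the adjoint of that relation is the claim.
No normality of `X` is involved, in contrast to Fuglede's theorem. -/
theorem commute_star_of_mem_unitary {X U : H →L[ℂ] H} (hU : U ∈ unitary (H →L[ℂ] H))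
    (h : X * U = U * X) : Commute (star X) U := by
  have h' : star U * star X = star X * star U := by rw [← star_mul, h, star_mul]
  calc star X * U = U * (star U * star X) * U := by rw [← mul_assoc, hU.2, one_mul]
    _ = U * star X := by rw [h', mul_assoc, mul_assoc, hU.1, mul_one]

/-- Joint bounded-belowness makes the Koszul complex of a commuting triple of normal operators
exact. -/
theorem koszulExact_of_bounded_below {T : Fin 3 → H →L[ℂ] H} (hT : CommutingTriple T)
    (hN : ∀ i, IsStarNormal (T i)) {c : ℝ} (hc : 0 < c)
    (h : ∀ x, c * ‖x‖ ^ 2 ≤ ‖T 0 x‖ ^ 2 + ‖T 1 x‖ ^ 2 + ‖T 2 x‖ ^ 2) : KoszulExact T := by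
  obtain ⟨S, hS⟩ := isUnit_sum_of_bounded_below T hc h
  have hTT (i j) : Commute (T i) (T j) := hT i j
  have hsT (i j) : Commute (star (T i)) (T j) := (hN i).commute_star_left (hTT i j)
  have hST (j) : Commute (S : H →L[ℂ] H) (T j) := by
    rw [hS]
    exact (((hsT 0 j).mul_left (hTT 0 j)).add_left ((hsT 1 j).mul_left (hTT 1 j))).add_left
      ((hsT 2 j).mul_left (hTT 2 j))
  refine koszulExact_of_left_inverse (R := fun i => (↑S⁻¹ : H →L[ℂ] H) * star (T i)) ?_ ?_
  · exact fun i j => ((hST j).units_inv_left.mul_left (hsT i j)).eq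
  · simp only [mul_assoc]
    rw [← mul_add, ← mul_add, ← hS, Units.inv_mul]

open scoped IsMulCommutative in
/-- The values of a character of the commutative C⋆-algebra generated by a tetrablock unitary lie in
its Taylor spectrum, so that the relations defining the distinguished boundary pass to it. -/
theorem IsTetrablockUnitary.relations {N : Fin 3 → H →L[ℂ] H} (h : IsTetrablockUnitary N) :
    star (N 2) * N 2 = 1 ∧ N 0 = star (N 1) * N 2 ∧ ‖N 1‖ ≤ 1 := by
  obtain ⟨hN, hn, hsp⟩ := h
  let s : Set (H →L[ℂ] H) := Set.range N
  let S : StarSubalgebra ℂ (H →L[ℂ] H) := (StarAlgebra.adjoin ℂ s).topologicalClosure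
  have hSc : IsClosed (S : Set (H →L[ℂ] H)) :=
    (StarAlgebra.adjoin ℂ s).isClosed_topologicalClosure
  have : IsMulCommutative (StarAlgebra.adjoin ℂ s) := by
    refine StarAlgebra.isMulCommutative_adjoin ℂ ?_ ?_
    · rintro _ ⟨i, rfl⟩ _ ⟨j, rfl⟩
      exact hN i j
    · rintro _ ⟨i, rfl⟩ _ ⟨j, rfl⟩
      exact ((hn j).commute_star_right (hN i j)).eq
  let _ : CommRing S := (StarAlgebra.adjoin ℂ s).commRingTopologicalClosure mul_comm
  let _ : CommCStarAlgebra S := { }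
  let n (i : Fin 3) : S := ⟨N i, (StarAlgebra.adjoin ℂ s).le_topologicalClosure
    (StarAlgebra.subset_adjoin ℂ s ⟨i, rfl⟩)⟩
  have hchar (χ : WeakDual.characterSpace ℂ S) :
      χ (n 0) = conj (χ (n 1)) * χ (n 2) ∧ ‖χ (n 2)‖ = 1 ∧ ‖χ (n 1)‖ ≤ 1 := by
    have hmem : (fun i => χ (n i)) ∈ taylorSpectrum N := by
      intro hK
      obtain ⟨c, hc, hb⟩ := exists_bounded_below_of_koszul2_surjective _ hK.2.2.2
      -- Off the spectrum `∑ (Nᵢ - χ(nᵢ)) (Nᵢ - χ(nᵢ))*` is invertible; the bound concerns adjoints,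
      -- hence the double stars below.
      have hu := isUnit_sum_of_bounded_below (fun i => star (N i - χ (n i) • (1 : H →L[ℂ] H))) hc hb
      let m (i : Fin 3) : S := n i - χ (n i) • 1
      have hu' : IsUnit (star (star (m 0)) * star (m 0) + star (star (m 1)) * star (m 1) +
          star (star (m 2)) * star (m 2)) := by
        -- Spectral permanence: the inverse already lies in `S`, so `χ` of the sum is invertible.
        -- But `χ` kills each `m i`.
        rw [← StarSubalgebra.coe_isUnit]
        exact hu
      have hm (i) : χ (m i) = 0 := by simp [m]
      have := hu'.map χ
      simp [hm] at this
    have := mem_distinguishedBoundary_iff.mp (hsp hmem)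
    exact this
  obtain ⟨h2, h0, h1⟩ := relations_of_forall_character n hchar
  exact ⟨congrArg Subtype.val h2, congrArg Subtype.val h0, h1⟩

/-- A commuting triple `(N₁, N₂, U)` with `U` unitary, `N₁ = N₂* U` and `‖N₂‖ ≤ 1` is a tetrablock
unitary. -/
theorem isTetrablockUnitary_of_relations {N : Fin 3 → H →L[ℂ] H} (hN : CommutingTriple N)
    (hU : N 2 ∈ unitary (H →L[ℂ] H)) (h0 : N 0 = star (N 1) * N 2) (h1 : ‖N 1‖ ≤ 1) :
    IsTetrablockUnitary N := by
  have hs1 : star (N 1) = N 0 * star (N 2) := by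
    rw [h0, mul_assoc, hU.2, mul_one]
  have hn2 : IsStarNormal (N 2) := ⟨by rw [commute_iff_eq, hU.1, hU.2]⟩
  -- `star (N 1) = N 0 * star (N 2)`, and both factors commute with `N 1`, the second by Fuglede's
  -- theorem for the normal operator `N 2`.
  have hn1 : IsStarNormal (N 1) := ⟨by
    rw [hs1]
    exact Commute.mul_left (hN 0 1) (hn2.commute_star_left (hN 2 1))⟩
  have hn0 : IsStarNormal (N 0) := ⟨by
    have e : star (N 0) = star (N 2) * N 1 := by rw [h0, star_mul, star_star]
    rw [e, h0]
    exact ((Commute.star_star (hN 1 2)).symm.mul_right hn2.star_comm_self).mul_left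
      (hn1.star_comm_self.symm.mul_right (hN 1 2))⟩
  have hn : ∀ i, IsStarNormal (N i) := by
    intro i
    fin_cases i
    exacts [hn0, hn1, hn2]
  have hUn (x : H) : ‖N 2 x‖ = ‖x‖ := norm_map_of_mem_unitary hU x
  refine ⟨hN, hn, fun z hz => ?_⟩
  set M : Fin 3 → H →L[ℂ] H := fun i => N i - z i • 1 with hM
  have hMc : CommutingTriple M := fun i j => by
    have : Commute (N i) (N j) := hN i j
    exact ((this.sub_left ((Commute.one_left _).smul_left _)).sub_right
      ((Commute.one_right _).smul_right _)).eq
  have hMn (i) : IsStarNormal (M i) := ⟨by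
    have := (hn i).star_comm_self
    simp only [hM, star_sub, star_smul, star_one]
    exact (this.sub_left ((Commute.one_left _).smul_left _)).sub_right
      ((Commute.one_right _).smul_right _)⟩
  by_contra hzb
  -- A point off the boundary violates one of its three conditions; each violation bounds the
  -- shifted triple below, so the Koszul complex is exact there.
  have key {c : ℝ} (hc : 0 < c)
      (h : ∀ x, c * ‖x‖ ≤ ‖M 0 x‖ + ‖M 1 x‖ + ‖M 2 x‖) : False := by
    refine hz (koszulExact_of_bounded_below hMc hMn (c := c ^ 2 / 3) (by positivity) fun x => ?_)
    have h1 : (c * ‖x‖) ^ 2 ≤ (‖M 0 x‖ + ‖M 1 x‖ + ‖M 2 x‖) ^ 2 := by gcongr; exact h x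
    nlinarith [sq_nonneg (‖M 0 x‖ - ‖M 1 x‖), sq_nonneg (‖M 0 x‖ - ‖M 2 x‖),
      sq_nonneg (‖M 1 x‖ - ‖M 2 x‖)]
  have hMx (i) (x : H) : M i x = N i x - z i • x := by simp [hM]
  by_cases hz2 : ‖z 2‖ = 1
  · by_cases hz1 : ‖z 1‖ ≤ 1
    · have hd : conj (z 1) * z 2 - z 0 ≠ 0 := fun hd =>
        hzb (mem_distinguishedBoundary_iff.mpr ⟨(sub_eq_zero.mp hd).symm, hz2, hz1⟩)
      refine key (norm_pos_iff.mpr hd) fun x => ?_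
      have e : (conj (z 1) * z 2 - z 0) • x =
          M 0 x - star (M 1) (N 2 x) - conj (z 1) • M 2 x := by
        rw [hMx, hMx]
        simp only [hM, star_sub, star_smul, star_one]
        rw [h0]
        simp [sub_smul, smul_sub, mul_smul]
      have e1 : ‖star (M 1) (N 2 x)‖ = ‖M 1 x‖ := by
        have hc : M 1 (N 2 x) = N 2 (M 1 x) := congrArg (· x)
          ((show Commute (N 1) (N 2) from hN 1 2).sub_left ((Commute.one_left _).smul_left _)).eq
        rw [star_eq_adjoint, ← ContinuousLinearMap.isStarNormal_iff_norm_eq_adjoint.mp (hMn 1),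
          hc, hUn]
      rw [← norm_smul, e]
      calc _ ≤ ‖M 0 x‖ + ‖star (M 1) (N 2 x)‖ + ‖conj (z 1) • M 2 x‖ :=
            (norm_sub_le _ _).trans (by gcongr; exact norm_sub_le _ _)
        _ ≤ _ := by
          rw [e1, norm_smul, RCLike.norm_conj]
          gcongr
          exact mul_le_of_le_one_left (norm_nonneg _) hz1
    · refine key (sub_pos.mpr (not_le.mp hz1)) fun x => ?_
      have h2 : ‖z 1 • x‖ - ‖N 1 x‖ ≤ ‖M 1 x‖ := by
        rw [hMx, norm_sub_rev]; exact norm_sub_norm_le _ _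
      have h3 : ‖N 1 x‖ ≤ 1 * ‖x‖ := (N 1).le_of_opNorm_le h1 x
      rw [norm_smul] at h2
      linarith [norm_nonneg (M 0 x), norm_nonneg (M 2 x)]
  · refine key (abs_pos.mpr (sub_ne_zero.mpr hz2)) fun x => ?_
    have h2 : |‖z 2 • x‖ - ‖N 2 x‖| ≤ ‖M 2 x‖ := by
      rw [hMx, norm_sub_rev]; exact abs_norm_sub_norm_le _ _
    rw [norm_smul, hUn, ← sub_one_mul, abs_mul, abs_norm] at h2
    linarith [norm_nonneg (M 0 x), norm_nonneg (M 1 x)]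

end Operators

/-! ### The shift and the backward shift on `ℓ²(E)` -/

section Shift

variable {E : Type u} [NormedAddCommGroup E] [InnerProductSpace ℂ E]

/-- The embedding of `E` as the `n`-th coordinate of `ℓ²(E)`. -/
abbrev sgl (n : ℕ) : E →L[ℂ] Ell2 E := lp.singleContinuousLinearMap ℂ (fun _ : ℕ => E) 2 n

/-- The diagonal operator on `ℓ²(E)` with constant entry `a`. -/
def diag (a : E →L[ℂ] E) : Ell2 E →L[ℂ] Ell2 E :=
  lp.mapCLM 2 (fun _ : ℕ => a) (norm_nonneg a) (fun _ => le_rfl)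

theorem diag_apply (a : E →L[ℂ] E) (x : Ell2 E) (n : ℕ) : diag a x n = a (x n) := rfl

theorem sgl_apply_coe (n : ℕ) (e : E) (m : ℕ) : (sgl n e : Ell2 E) m = if m = n then e else 0 := by
  rw [lp.singleContinuousLinearMap_apply, lp.single_apply, Pi.single_apply]

theorem norm_sgl (n : ℕ) (e : E) : ‖sgl n e‖ = ‖e‖ := by
  rw [lp.singleContinuousLinearMap_apply, lp.norm_single (by norm_num)]

theorem inner_sgl_left (n : ℕ) (e : E) (x : Ell2 E) : inner ℂ (sgl n e) x = inner ℂ e (x n) := by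
  rw [lp.singleContinuousLinearMap_apply, lp.inner_single_left]

theorem inner_sgl_right (n : ℕ) (e : E) (x : Ell2 E) : inner ℂ x (sgl n e) = inner ℂ (x n) e := by
  rw [lp.singleContinuousLinearMap_apply, lp.inner_single_right]

theorem hasSum_sgl (x : Ell2 E) : HasSum (fun n => sgl n (x n)) x :=
  lp.hasSum_single (by norm_num) x

theorem ell2_clm_ext {F : Type*} [NormedAddCommGroup F] [NormedSpace ℂ F] {f g : Ell2 E →L[ℂ] F}
    (h : ∀ n e, f (sgl n e) = g (sgl n e)) : f = g :=
  lp.ext_continuousLinearMap (by norm_num) fun n => ContinuousLinearMap.ext (h n)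

theorem orthogonalFamily_sgl_succ : OrthogonalFamily ℂ (fun _ : ℕ => E)
    (fun n => ⟨(sgl (E := E) (n + 1)).toLinearMap, norm_sgl (n + 1)⟩ : ℕ → E →ₗᵢ[ℂ] Ell2 E) := by
  intro m n hmn x y
  change inner ℂ (sgl (m + 1) x) (sgl (n + 1) y) = 0
  rw [inner_sgl_left, sgl_apply_coe, if_neg (by omega), inner_zero_right]

variable [CompleteSpace E]

variable (E) in
/-- The unilateral shift on `ℓ²(E)`. -/
def shift : Ell2 E →L[ℂ] Ell2 E := orthogonalFamily_sgl_succ.linearIsometry.toContinuousLinearMap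

variable (E) in
/-- The backward shift on `ℓ²(E)`. -/
def bshift : Ell2 E →L[ℂ] Ell2 E := (shift E)†

theorem norm_shift (x : Ell2 E) : ‖shift E x‖ = ‖x‖ := LinearIsometry.norm_map _ x

theorem shift_sgl (n : ℕ) (e : E) : shift E (sgl n e) = sgl (n + 1) e := by
  exact orthogonalFamily_sgl_succ.linearIsometry_apply_single e

theorem bshift_apply (x : Ell2 E) (n : ℕ) : bshift E x n = x (n + 1) := by
  refine ext_inner_left ℂ fun e => ?_
  rw [← inner_sgl_left, bshift, adjoint_inner_right, shift_sgl, inner_sgl_left]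

theorem bshift_shift (x : Ell2 E) : bshift E (shift E x) = x := by
  refine ext_inner_left ℂ fun y => ?_
  rw [bshift, adjoint_inner_right]
  exact LinearIsometry.inner_map_map _ y x

theorem bshift_sgl_zero (e : E) : bshift E (sgl 0 e) = 0 := by
  ext n
  rw [bshift_apply, sgl_apply_coe, if_neg (by omega)]
  rfl

theorem norm_sq_eq_bshift (x : Ell2 E) : ‖x‖ ^ 2 = ‖x 0‖ ^ 2 + ‖bshift E x‖ ^ 2 := by
  have h (y : Ell2 E) : HasSum (fun n => ‖y n‖ ^ 2) (‖y‖ ^ 2) := by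
    simpa using lp.hasSum_norm (by norm_num) y
  have h1 := (hasSum_nat_add_iff' 1).mpr (h x)
  have h2 := h (bshift E x)
  simp only [bshift_apply] at h2
  have := h1.unique h2
  simp at this
  linarith

theorem shift_apply_zero (x : Ell2 E) : shift E x 0 = 0 := by
  have := norm_sq_eq_bshift (shift E x)
  rw [norm_shift, bshift_shift] at this
  simpa using this

/-- The powers are contractions and eventually annihilate every finitely supported vector. -/
theorem tendsto_bshift_pow (x : Ell2 E) :
    Filter.Tendsto (fun n => (bshift E ^ n) x) Filter.atTop (nhds 0) := by
  have hB (n : ℕ) (y : Ell2 E) : ‖(bshift E ^ n) y‖ ≤ ‖y‖ := by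
    induction n with
    | zero => simp
    | succ n ih =>
      rw [pow_succ']
      refine le_trans ?_ ih
      change ‖bshift E ((bshift E ^ n) y)‖ ≤ _
      have := norm_sq_eq_bshift ((bshift E ^ n) y)
      exact (sq_le_sq₀ (norm_nonneg _) (norm_nonneg _)).mp (by nlinarith [sq_nonneg ‖((bshift E ^ n) y) 0‖]) 
  have hk (m n : ℕ) (h : m < n) (e : E) : (bshift E ^ n) (sgl m e) = 0 := by
    induction n generalizing m with
    | zero => omega
    | succ n ih =>
      rw [pow_succ]
      change (bshift E ^ n) (bshift E (sgl m e)) = 0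
      cases m with
      | zero => rw [bshift_sgl_zero, map_zero]
      | succ m => rw [← shift_sgl, bshift_shift]; exact ih m (by omega)
  have ht := (hasSum_sgl x).tendsto_sum_nat
  rw [tendsto_iff_norm_sub_tendsto_zero] at ht
  refine squeeze_zero_norm (fun n => ?_) ht
  have : (bshift E ^ n) x = (bshift E ^ n) (x - ∑ i ∈ Finset.range n, sgl i (x i)) := by
    rw [map_sub, map_sum, Finset.sum_eq_zero, sub_zero]
    exact fun i hi => hk i n (Finset.mem_range.mp hi) _
  rw [this, norm_sub_rev]
  exact hB n _

end Shift

/-! ### Unitary extensions and the criterion for tetrablock isometries -/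

section Extension

variable {K : Type u} [NormedAddCommGroup K] [InnerProductSpace ℂ K] [CompleteSpace K]

/-- The subspace `ker V*`, the orthogonal complement of the range of `V`. -/
abbrev coker (V : K →L[ℂ] K) : Submodule ℂ K := (V†).ker

instance (V : K →L[ℂ] K) : CompleteSpace (coker V) :=
  (V†).isClosed_ker.completeSpace_coe

/-- The Hilbert space `K ⊕ ℓ²(ker V*)` of the unitary extension of an isometry `V`. -/
abbrev ExtSpace (V : K →L[ℂ] K) : Type u := WithLp 2 (K × Ell2 (coker V))

variable {V : K →L[ℂ] K} (hV : star V * V = 1)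

include hV in
theorem adjoint_apply_isometry (x : K) : (V†) (V x) = x := congrArg (· x) hV

include hV in
theorem norm_isometry_apply (x : K) : ‖V x‖ = ‖x‖ :=
  (norm_map_iff_adjoint_comp_self V).mpr hV x

/-- The projection `1 - V V*` onto `ker V*`. -/
def cokerProj : K →L[ℂ] coker V :=
  (1 - V ∘L V†).codRestrict (coker V) fun x => by
    simp [adjoint_apply_isometry hV]

theorem coe_cokerProj (x : K) : (cokerProj hV x : K) = x - V ((V†) x) := rfl

/-- The unitary extension `(k, x) ↦ (V k + x₀, (x₁, x₂, …))` of the isometry `V`. -/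
def unitaryExt (V : K →L[ℂ] K) : ExtSpace V →L[ℂ] ExtSpace V :=
  (WithLp.prodContinuousLinearEquiv 2 ℂ K (Ell2 (coker V))).symm.toContinuousLinearMap ∘L
    ((V ∘L WithLp.fstL 2 ℂ _ _ +
        (coker V).subtypeL ∘L lp.evalCLM ℂ (fun _ : ℕ => coker V) 2 0 ∘L WithLp.sndL 2 ℂ _ _).prod
      (bshift (coker V) ∘L WithLp.sndL 2 ℂ _ _))

theorem unitaryExt_apply (k : K) (x : Ell2 (coker V)) :
    unitaryExt V (WithLp.toLp 2 (k, x)) = WithLp.toLp 2 (V k + x 0, bshift (coker V) x) := rfl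

theorem unitaryExt_inl (k : K) : unitaryExt V (inlIsometry k) = inlIsometry (V k) := by
  change unitaryExt V (WithLp.toLp 2 (k, 0)) = WithLp.toLp 2 (V k, 0)
  rw [unitaryExt_apply]
  simp

-- Norms are preserved because the range of `V` is orthogonal to `ker V*`. Surjectivity comes from
-- the splitting `k = V V* k + (1 - V V*) k`, with the second part stored in coordinate 0.
include hV in
theorem unitaryExt_mem_unitary : unitaryExt V ∈ unitary (ExtSpace V →L[ℂ] ExtSpace V) := by
  have h1 : star (unitaryExt V) * unitaryExt V = 1 := by
    refine (norm_map_iff_adjoint_comp_self (unitaryExt V)).mp fun y => ?_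
    obtain ⟨k, x⟩ := y
    rw [unitaryExt_apply, ← sq_eq_sq₀ (norm_nonneg _) (norm_nonneg _),
      WithLp.prod_norm_sq_eq_of_L2, WithLp.prod_norm_sq_eq_of_L2]
    change ‖V k + x 0‖ ^ 2 + ‖bshift _ x‖ ^ 2 = ‖k‖ ^ 2 + ‖x‖ ^ 2
    have : inner ℂ (V k) (x 0 : K) = 0 := by
      rw [← adjoint_inner_right, show (V†) (x 0 : K) = 0 from (x 0).2, inner_zero_right]
    rw [norm_sq_eq_bshift x, sq, norm_add_sq_eq_norm_sq_add_norm_sq_of_inner_eq_zero _ _ this,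
      norm_isometry_apply hV, Submodule.coe_norm]
    ring
  have hsurj : Function.Surjective (unitaryExt V) := by
    rintro ⟨k, x⟩
    refine ⟨WithLp.toLp 2 ((V†) k, sgl 0 (cokerProj hV k) + shift _ x), ?_⟩
    rw [unitaryExt_apply, map_add, bshift_sgl_zero, bshift_shift, zero_add, lp.coeFn_add,
      Pi.add_apply, shift_apply_zero, sgl_apply_coe, if_pos rfl, add_zero, coe_cokerProj,
      add_sub_cancel]
  refine ⟨h1, ?_⟩
  ext1 y
  obtain ⟨w, rfl⟩ := hsurj y
  exact congrArg (unitaryExt V) (adjoint_apply_isometry h1 w)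

/-- An operator commuting with the unitary extension is bounded by its bound on `K`. -/
theorem norm_le_of_commute_unitaryExt {X : ExtSpace V →L[ℂ] ExtSpace V}
    (hX : X * unitaryExt V = unitaryExt V * X) (hV : star V * V = 1) {c : ℝ} (hc : 0 ≤ c)
    (h : ∀ k : K, ‖X (inlIsometry k)‖ ≤ c * ‖k‖) (y : ExtSpace V) : ‖X y‖ ≤ c * ‖y‖ := by
  have hU := unitaryExt_mem_unitary hV
  have hUn (n : ℕ) : unitaryExt V ^ n ∈ unitary _ := pow_mem hU n
  have hXn (n : ℕ) : X ((unitaryExt V ^ n) y) = (unitaryExt V ^ n) (X y) :=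
    congrArg (· y) ((show Commute X (unitaryExt V) from hX).pow_right n).eq
  have hsnd (n : ℕ) : ((unitaryExt V ^ n) y).snd = (bshift (coker V) ^ n) y.snd := by
    induction n with
    | zero => rfl
    | succ n ih =>
      rw [pow_succ', pow_succ']
      change bshift _ ((unitaryExt V ^ n) y).snd = bshift _ ((bshift _ ^ n) y.snd)
      rw [ih]
  -- `U = unitaryExt V` commutes with `X` and preserves norms, so `y` may be replaced by `Uⁿ y`,
  -- whose `ℓ²` component tends to 0: asymptotically only `K` matters.
  have hb (n : ℕ) : ‖X y‖ ≤ c * ‖y‖ + ‖X‖ * ‖(bshift (coker V) ^ n) y.snd‖ := by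
    rw [← norm_map_of_mem_unitary (hUn n) (X y), ← hXn, ← norm_map_of_mem_unitary (hUn n) y,
      ← hsnd]
    generalize (unitaryExt V ^ n) y = w
    have hw : w = inlIsometry w.fst + WithLp.toLp 2 (0, w.snd) := by
      change w = WithLp.toLp 2 (w.fst, 0) + WithLp.toLp 2 (0, w.snd)
      rw [← WithLp.toLp_add, Prod.mk_add_mk, add_zero, zero_add]
      rfl
    have hw1 : ‖w.fst‖ ≤ ‖w‖ := by
      rw [← sq_le_sq₀ (norm_nonneg _) (norm_nonneg _), WithLp.prod_norm_sq_eq_of_L2]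
      nlinarith [sq_nonneg ‖w.snd‖]
    calc ‖X w‖ ≤ ‖X (inlIsometry w.fst)‖ + ‖X (WithLp.toLp 2 (0, w.snd))‖ := by
          conv_lhs => rw [hw, map_add]
          exact norm_add_le _ _
      _ ≤ c * ‖w‖ + ‖X‖ * ‖w.snd‖ := by
          refine add_le_add ((h _).trans (by gcongr)) ((le_opNorm _ _).trans ?_)
          rw [WithLp.norm_toLp_snd]
  have := ((tendsto_bshift_pow y.snd).norm.const_mul ‖X‖).const_add (c * ‖y‖)
  rw [norm_zero, mul_zero, add_zero] at this
  exact ge_of_tendsto' this hb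

/-- Operators commuting with the unitary extension are determined on `K`. -/
theorem eq_zero_of_commute_unitaryExt {X : ExtSpace V →L[ℂ] ExtSpace V}
    (hX : X * unitaryExt V = unitaryExt V * X) (hV : star V * V = 1)
    (h : ∀ k : K, X (inlIsometry k) = 0) : X = 0 := by
  ext1 y
  have := norm_le_of_commute_unitaryExt hX hV le_rfl (fun k => by rw [h, norm_zero, zero_mul]) y
  rw [zero_mul] at this
  exact norm_le_zero_iff.mp this

variable {X Y : K →L[ℂ] K}

/-- The extension of `X` to an operator commuting with `unitaryExt V`, when `Y = X* V` and
`X = Y* V`. -/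
def commExt (X Y : K →L[ℂ] K) : ExtSpace V →L[ℂ] ExtSpace V :=
  (WithLp.prodContinuousLinearEquiv 2 ℂ K (Ell2 (coker V))).symm.toContinuousLinearMap ∘L
    ((X ∘L WithLp.fstL 2 ℂ _ _ + Y† ∘L (coker V).subtypeL ∘L
        lp.evalCLM ℂ (fun _ : ℕ => coker V) 2 0 ∘L WithLp.sndL 2 ℂ _ _).prod
      ((diag (cokerProj hV ∘L X ∘L (coker V).subtypeL) +
        diag (cokerProj hV ∘L Y† ∘L (coker V).subtypeL) ∘L bshift (coker V)) ∘L
          WithLp.sndL 2 ℂ _ _))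

theorem commExt_apply (k : K) (x : Ell2 (coker V)) :
    commExt hV X Y (WithLp.toLp 2 (k, x)) = WithLp.toLp 2 (X k + (Y†) (x 0 : K),
      diag (cokerProj hV ∘L X ∘L (coker V).subtypeL) x +
        diag (cokerProj hV ∘L Y† ∘L (coker V).subtypeL) (bshift (coker V) x)) := rfl

theorem commExt_inl (k : K) : commExt hV X Y (inlIsometry k) = inlIsometry (X k) := by
  change commExt hV X Y (WithLp.toLp 2 (k, 0)) = WithLp.toLp 2 (X k, 0)
  rw [commExt_apply]
  simp

/-- On `e ∈ ker V*` two facts suffice: `V* Y* e = Y* V* e = 0`, so `Y* e` is again in `ker V*`, and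
`Y* = V* X`, so `X e = V Y* e + (1 - V V*) X e`. -/
theorem commExt_mul_unitaryExt (hXV : X * V = V * X) (hYV : Y * V = V * Y)
    (hY : Y = star X * V) :
    commExt hV X Y * unitaryExt V = unitaryExt V * commExt hV X Y := by
  ext1 y
  obtain ⟨k, x⟩ := y
  change commExt hV X Y (unitaryExt V (WithLp.toLp 2 (k, x))) =
    unitaryExt V (commExt hV X Y (WithLp.toLp 2 (k, x)))
  have hYs (e : coker V) : (V†) ((Y†) (e : K)) = 0 := by
    have : (V†) ((Y†) (e : K)) = (Y†) ((V†) (e : K)) :=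
      congrArg (· (e : K)) (show star V * star Y = star Y * star V by
        rw [← star_mul, hYV, star_mul])
    rw [this, show (V†) (e : K) = 0 from e.2, map_zero]
  have hYX (e : K) : (Y†) e = (V†) (X e) :=
    congrArg (· e) (show star Y = star V * X by rw [hY, star_mul, star_star])
  have hXVk : X (V k) = V (X k) := congrArg (· k) hXV
  rw [unitaryExt_apply, commExt_apply, commExt_apply, unitaryExt_apply]
  congr 2
  · rw [lp.coeFn_add, Pi.add_apply, diag_apply, diag_apply, bshift_apply]
    simp only [map_add, comp_apply, Submodule.subtypeL_apply, Submodule.coe_add, coe_cokerProj,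
      hYs, map_zero, sub_zero, hXVk, zero_add]
    rw [hYX (x 0)]
    abel
  · ext n : 2
    simp only [lp.coeFn_add, Pi.add_apply, diag_apply, bshift_apply]

/-- Algebraic criterion for being a tetrablock isometry. -/
theorem isTetrablockIsometry_of_relations {V : Fin 3 → K →L[ℂ] K} (hC : CommutingTriple V)
    (h2 : star (V 2) * V 2 = 1) (h0 : V 0 = star (V 1) * V 2) (h1 : ‖V 1‖ ≤ 1) :
    IsTetrablockIsometry V := by
  have h0' : V 1 = star (V 0) * V 2 := by
    rw [h0, star_mul, star_star, mul_assoc, hC 1 2, ← mul_assoc, h2, one_mul]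
  set U := unitaryExt (V 2)
  set N1 := commExt h2 (V 1) (V 0)
  set N0 := commExt h2 (V 0) (V 1)
  have hU : U ∈ unitary _ := unitaryExt_mem_unitary h2
  have c1 : N1 * U = U * N1 := commExt_mul_unitaryExt h2 (hC 1 2) (hC 0 2) h0
  have c0 : N0 * U = U * N0 := commExt_mul_unitaryExt h2 (hC 0 2) (hC 1 2) h0'
  have cs : Commute (star N1) U :=
    commute_star_of_mem_unitary hU c1
  -- Both sides commute with `U`, so it is enough to compare them on `K`. There the only term not
  -- covered by `V 0 = star (V 1) * V 2` pairs the range of `V 2` with `ker (V 2)*`.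
  have e0 : N0 = star N1 * U := by
    refine sub_eq_zero.mp (eq_zero_of_commute_unitaryExt ?_ h2 fun k => ?_)
    · exact ((show Commute N0 U from c0).sub_left (cs.mul_left (Commute.refl U))).eq
    · refine ext_inner_right ℂ fun y => ?_
      obtain ⟨k', x⟩ := y
      rw [sub_apply, inner_sub_left, commExt_inl]
      change _ - inner ℂ (star N1 (U (inlIsometry k))) _ = _
      rw [unitaryExt_inl, star_eq_adjoint, adjoint_inner_left, commExt_apply, inner_zero_left]
      change inner ℂ (WithLp.toLp 2 (V 0 k, 0)) _ - inner ℂ (WithLp.toLp 2 (V 2 k, 0)) _ = _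
      rw [WithLp.prod_inner_apply, WithLp.prod_inner_apply]
      change inner ℂ (V 0 k) k' + inner ℂ 0 x - (inner ℂ (V 2 k) (V 1 k' + ((V 0)†) (x 0 : K))
        + inner ℂ 0 _) = 0
      have e1 : V 0 k = ((V 1)†) (V 2 k) := congrArg (· k) h0
      have e2 : V 0 (V 2 k) = V 2 (V 0 k) := congrArg (· k) (hC 0 2)
      have e3 : inner ℂ (V 2 (V 0 k)) (x 0 : K) = 0 := by
        rw [← adjoint_inner_right, show ((V 2)†) (x 0 : K) = 0 from (x 0).2, inner_zero_right]
      rw [inner_add_right, adjoint_inner_right, e2, e3, e1, adjoint_inner_left, inner_zero_left,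
        inner_zero_left, add_zero, add_zero, sub_self]
  have c01 : N0 * N1 = N1 * N0 := by
    have a0 : Commute N0 U := c0
    have a1 : Commute N1 U := c1
    refine sub_eq_zero.mp (eq_zero_of_commute_unitaryExt ?_ h2 fun k => ?_)
    · exact ((a0.mul_left a1).sub_left (a1.mul_left a0)).eq
    · change N0 (N1 (inlIsometry k)) - N1 (N0 (inlIsometry k)) = 0
      rw [commExt_inl, commExt_inl, commExt_inl, commExt_inl,
        show V 0 (V 1 k) = V 1 (V 0 k) from congrArg (· k) (hC 0 1), sub_self]
  have n1 : ‖N1‖ ≤ 1 := opNorm_le_bound _ zero_le_one <|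
    norm_le_of_commute_unitaryExt c1 h2 zero_le_one fun k => by
      rw [commExt_inl, LinearIsometry.norm_map]
      exact (V 1).le_of_opNorm_le h1 k
  refine ⟨ExtSpace (V 2), inferInstance, inferInstance, inferInstance, ![N0, N1, U], inlIsometry,
    isTetrablockUnitary_of_relations ?_ hU e0 n1, ?_⟩
  · intro i j
    fin_cases i <;> fin_cases j
    exacts [rfl, c01, c0, c01.symm, rfl, c1, c0.symm, c1.symm, rfl]
  · intro i k
    fin_cases i
    exacts [commExt_inl h2 k, commExt_inl h2 k, unitaryExt_inl k]

/-- The relations of the unitary triple survive restriction because they can be tested by inner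
products of vectors in the subspace. Commutation and `V₃* V₃ = 1` then give the mirrored relation
`V₂ = V₁* V₃`. -/
theorem IsTetrablockIsometry.relations {V : Fin 3 → K →L[ℂ] K} (h : IsTetrablockIsometry V) :
    CommutingTriple V ∧ star (V 2) * V 2 = 1 ∧ V 0 = star (V 1) * V 2 ∧
      V 1 = star (V 0) * V 2 ∧ ‖V 0‖ ≤ 1 ∧ ‖V 1‖ ≤ 1 := by
  obtain ⟨L, _, _, _, N, ι, hN, hι⟩ := h
  obtain ⟨h2, h0, h1⟩ := hN.relations
  have hC : CommutingTriple V := fun i j => by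
    ext1 x
    apply ι.injective
    change ι (V i (V j x)) = ι (V j (V i x))
    rw [← hι, ← hι, ← hι, ← hι]
    exact congrArg (· (ι x)) (hN.1 i j)
  have hV2 : star (V 2) * V 2 = 1 :=
    (norm_map_iff_adjoint_comp_self (V 2)).mp fun x => by
      rw [← ι.norm_map, ← hι, norm_isometry_apply h2, ι.norm_map]
  have hV0 : V 0 = star (V 1) * V 2 := by
    ext1 x
    refine ext_inner_left ℂ fun y => ?_
    change inner ℂ y (V 0 x) = inner ℂ y (star (V 1) (V 2 x))
    rw [star_eq_adjoint, adjoint_inner_right, ← ι.inner_map_map, ← ι.inner_map_map (V 1 y), ← hι,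
      ← hι, ← hι, h0]
    change inner ℂ (ι y) (star (N 1) (N 2 (ι x))) = _
    rw [star_eq_adjoint, adjoint_inner_right]
  have hV1 : ‖V 1‖ ≤ 1 := opNorm_le_bound _ zero_le_one fun x => by
    rw [← ι.norm_map, ← hι, ← ι.norm_map x]
    exact (N 1).le_of_opNorm_le h1 _
  refine ⟨hC, hV2, hV0, ?_, ?_, hV1⟩
  · rw [hV0, star_mul, star_star, mul_assoc, hC 1 2, ← mul_assoc, hV2, one_mul]
  · refine opNorm_le_bound _ zero_le_one fun x => ?_
    rw [hV0]
    change ‖star (V 1) (V 2 x)‖ ≤ _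
    rw [← norm_isometry_apply hV2 x]
    exact (star (V 1)).le_of_opNorm_le (by rwa [norm_star]) _

end Extension

/-! ### Toeplitz operators, their symbols and their norms -/

section Toeplitz

variable {E : Type u} [NormedAddCommGroup E] [InnerProductSpace ℂ E]

theorem ae_eq_zero_of_fourierCoeff_eq_zero {g : UnitAddCircle → ℂ} (hg : MemLp g 2 arc)
    (h : ∀ n, fourierCoeff g n = 0) : g =ᵐ[arc] 0 := by
  have h1 : ∀ n, fourierCoeff (hg.toLp g) n = 0 := fun n => by
    rw [← h n]
    refine integral_congr_ae ?_
    filter_upwards [hg.coeFn_toLp] with t ht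
    rw [ht]
  have h2 := hasSum_fourier_series_L2 (hg.toLp g)
  simp only [h1, zero_smul] at h2
  have h3 := h2.unique hasSum_zero
  filter_upwards [hg.coeFn_toLp, Lp.coeFn_zero ℂ 2 arc] with t ht h0
  rw [← ht, h3, h0]

theorem fourierCoeff_fun_sub {f g : UnitAddCircle → ℂ} (hf : Integrable f arc)
    (hg : Integrable g arc) (n : ℤ) :
    fourierCoeff (fun t => f t - g t) n = fourierCoeff f n - fourierCoeff g n := by
  have h {f : UnitAddCircle → ℂ} (hf : Integrable f arc) :
      Integrable (fun t => fourier (-n) t • f t) arc :=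
    hf.bdd_mul (c := 1) (fourier (-n)).continuous.aestronglyMeasurable_of_compactSpace
      (Filter.Eventually.of_forall fun t => (norm_fourier_apply _ _).le)
  unfold fourierCoeff
  simp only [smul_sub]
  exact integral_sub (h hf) (h hg)

theorem LInfSymbol.memLp_const (φ : LInfSymbol E) (e : E) :
    MemLp (fun t => φ.toFun t e) 2 arc := by
  obtain ⟨C, hC⟩ := φ.bdd
  refine MemLp.of_bound (φ.meas e) (C * ‖e‖) ?_
  filter_upwards [hC] with t ht
  exact (φ.toFun t).le_of_opNorm_le ht e

variable [CompleteSpace E]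

/-- An `L²` function on the circle vanishes almost everywhere if all its weak Fourier coefficients
do. -/
theorem ae_eq_zero_of_forall_fourierCoeff_inner {f : UnitAddCircle → E} (hf : MemLp f 2 arc)
    (h : ∀ e n, fourierCoeff (fun t => inner ℂ e (f t)) n = 0) : f =ᵐ[arc] 0 := by
  have hfi : Integrable f arc := hf.integrable (by norm_num)
  -- The null set off which `⟪e, f⟫` vanishes depends on `e`, and `E` need not be separable; passing
  -- to integrals over sets avoids uniting these null sets.
  refine hfi.ae_eq_zero_of_forall_setIntegral_eq_zero fun s hs _ => ?_
  refine ext_inner_left ℂ fun e => ?_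
  rw [← integral_inner hfi.integrableOn, inner_zero_right]
  have := ae_eq_zero_of_fourierCoeff_eq_zero (hf.const_inner e) (h e)
  exact integral_eq_zero_of_ae (ae_restrict_of_ae this)

theorem hardyEmb_sgl (n : ℕ) (e : E) : hardyEmb (sgl n e) = monomial n e :=
  orthogonalFamily_monomial.linearIsometry_apply_single e

theorem inner_toeplitz_sgl (φ : LInfSymbol E) (i j : ℕ) (e e' : E) :
    inner ℂ e' (toeplitz φ (sgl j e) i) =
      fourierCoeff (fun t => inner ℂ e' (φ.toFun t e)) (i - j : ℤ) := by
  rw [← inner_sgl_left, toeplitz, comp_apply, adjoint_inner_right, comp_apply]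
  change inner ℂ (hardyEmb (sgl i e')) (mulOp φ (hardyEmb (sgl j e))) = _
  rw [hardyEmb_sgl, hardyEmb_sgl, L2.inner_def]
  refine integral_congr_ae ?_
  filter_upwards [(memLp_monomial i e').coeFn_toLp, (memLp_monomial j e).coeFn_toLp,
    (φ.memLp_apply (monomial j e)).coeFn_toLp] with t h1 h2 h3
  change inner ℂ ((memLp_monomial i e').toLp _ t)
    ((φ.memLp_apply (monomial j e)).toLp _ t) = _
  rw [h1, h3]
  change inner ℂ _ (φ.toFun t ((memLp_monomial j e).toLp _ t)) = _
  rw [h2, map_smul, inner_smul_left, inner_smul_right, ← mul_assoc, ← fourier_neg, ← fourier_add,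
    smul_eq_mul]
  congr 3
  ring

theorem toeplitz_eq_iff (φ ψ : LInfSymbol E) :
    toeplitz φ = toeplitz ψ ↔ ∀ e, ∀ᵐ t ∂arc, φ.toFun t e = ψ.toFun t e := by
  constructor
  · intro h e
    have h0 : (fun t => φ.toFun t e - ψ.toFun t e) =ᵐ[arc] 0 := by
      refine ae_eq_zero_of_forall_fourierCoeff_inner
        ((φ.memLp_const e).sub (ψ.memLp_const e)) fun e' n => ?_
      -- Every integer is a difference of two naturals, so the matrix of `T_φ` contains all the
      -- Fourier coefficients of `φ`.
      have hn : n = ((n.toNat : ℕ) : ℤ) - (((-n).toNat : ℕ) : ℤ) := by omega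
      have h1 : fourierCoeff (fun t => inner ℂ e' (φ.toFun t e)) n =
          fourierCoeff (fun t => inner ℂ e' (ψ.toFun t e)) n := by
        rw [hn, ← inner_toeplitz_sgl, ← inner_toeplitz_sgl, h]
      have hi (χ : LInfSymbol E) : Integrable (fun t => inner ℂ e' (χ.toFun t e)) arc :=
        ((χ.memLp_const e).const_inner e').integrable (by norm_num)
      simp only [inner_sub_right]
      rw [fourierCoeff_fun_sub (hi φ) (hi ψ), h1, sub_self]
    filter_upwards [h0] with t ht
    exact sub_eq_zero.mp ht
  · intro h
    refine ell2_clm_ext fun j e => ?_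
    ext i
    refine ext_inner_left ℂ fun e' => ?_
    rw [inner_toeplitz_sgl, inner_toeplitz_sgl]
    refine integral_congr_ae ?_
    filter_upwards [h e] with t ht
    rw [ht]

omit [CompleteSpace E] in
theorem continuous_quadPoly (a b c : E →L[ℂ] E) : Continuous (quadPoly a b c) := by
  unfold quadPoly
  fun_prop

/-- The Toeplitz operator of `a + b z + c z²` in terms of the shift. -/
def quadToeplitz (a b c : E →L[ℂ] E) : Ell2 E →L[ℂ] Ell2 E :=
  diag a + diag b ∘L shift E + diag c ∘L shift E ∘L shift E

omit [CompleteSpace E] in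
theorem diag_sgl (a : E →L[ℂ] E) (n : ℕ) (e : E) : diag a (sgl n e) = sgl n (a e) := by
  ext m
  rw [diag_apply, sgl_apply_coe, sgl_apply_coe]
  split_ifs <;> simp

theorem quadToeplitz_sgl (a b c : E →L[ℂ] E) (n : ℕ) (e : E) :
    quadToeplitz a b c (sgl n e) = sgl n (a e) + sgl (n + 1) (b e) + sgl (n + 2) (c e) := by
  change diag a (sgl n e) + diag b (shift E (sgl n e)) + diag c (shift E (shift E (sgl n e))) = _
  rw [shift_sgl, shift_sgl, diag_sgl, diag_sgl, diag_sgl]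

/-- The symbol is analytic, so multiplication by it preserves the Hardy space and the compression
changes nothing. -/
theorem toeplitz_quadPoly (a b c : E →L[ℂ] E) :
    toeplitz (.ofContinuous (quadPoly a b c) (continuous_quadPoly a b c)) =
      quadToeplitz a b c := by
  refine ell2_clm_ext fun j e => ?_
  have h : mulOp (.ofContinuous (quadPoly a b c) (continuous_quadPoly a b c)) (monomial j e) =
      monomial j (a e) + monomial (j + 1) (b e) + monomial (j + 2) (c e) := by
    have m (i : ℕ) (x : E) := (memLp_monomial i x).coeFn_toLp
    refine Lp.ext ?_
    filter_upwards [m j e, m j (a e), m (j + 1) (b e), m (j + 2) (c e),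
      (LInfSymbol.memLp_apply (.ofContinuous (quadPoly a b c) (continuous_quadPoly a b c))
        (monomial j e)).coeFn_toLp,
      Lp.coeFn_add (monomial j (a e) + monomial (j + 1) (b e)) (monomial (j + 2) (c e)),
      Lp.coeFn_add (monomial j (a e)) (monomial (j + 1) (b e))] with t h1 h2 h3 h4 h5 h6 h7
    rw [h6, Pi.add_apply, h7, Pi.add_apply]
    refine h5.trans ?_
    change quadPoly a b c (fourier 1 t) ((memLp_monomial j e).toLp _ t) =
      (memLp_monomial j (a e)).toLp _ t + (memLp_monomial (j + 1) (b e)).toLp _ t +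
        (memLp_monomial (j + 2) (c e)).toLp _ t
    rw [h1, h2, h3, h4]
    have e1 : (fourier ((j + 1 : ℕ) : ℤ) t : ℂ) = fourier (j : ℤ) t * fourier 1 t := by
      rw [← fourier_add]; push_cast; rfl
    have e2 : (fourier ((j + 2 : ℕ) : ℤ) t : ℂ) = fourier (j : ℤ) t * fourier 1 t ^ 2 := by
      rw [sq, ← mul_assoc, ← fourier_add, ← fourier_add]; push_cast; congr 2
    rw [e1, e2]
    simp [quadPoly, smul_smul]
  rw [toeplitz, comp_apply, comp_apply]
  change (adjoint hardyEmb.toContinuousLinearMap) (mulOp _ (hardyEmb (sgl j e))) = _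
  rw [hardyEmb_sgl, h, ← hardyEmb_sgl, ← hardyEmb_sgl, ← hardyEmb_sgl, ← map_add, ← map_add,
    quadToeplitz_sgl]
  refine ext_inner_left ℂ fun y => ?_
  rw [adjoint_inner_right]
  exact (hardyEmb (E := E)).inner_map_map _ _

theorem represents_quadPoly_iff (φ : LInfSymbol E) (a b c : E →L[ℂ] E) :
    φ.Represents (quadPoly a b c) ↔ toeplitz φ = quadToeplitz a b c := by
  rw [← toeplitz_quadPoly, toeplitz_eq_iff]
  rfl

theorem toeplitz_zSq : toeplitz (zSq : LInfSymbol E) = quadToeplitz 0 0 1 := by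
  rw [← represents_quadPoly_iff]
  intro e
  filter_upwards with t
  simp [zSq, LInfSymbol.ofContinuous, quadPoly]

theorem shift_apply_succ (x : Ell2 E) (n : ℕ) : shift E x (n + 1) = x n := by
  rw [← bshift_apply, bshift_shift]

omit [CompleteSpace E] in
theorem norm_mulOp_le {φ : LInfSymbol E} {C : ℝ} (hC : 0 ≤ C)
    (h : ∀ᵐ t ∂arc, ‖φ.toFun t‖ ≤ C) : ‖mulOp φ‖ ≤ C := by
  refine opNorm_le_bound _ hC fun f => Lp.norm_le_mul_norm_of_ae_le_mul ?_
  filter_upwards [h, (φ.memLp_apply f).coeFn_toLp] with t ht ht'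
  refine (congrArg norm ht').trans_le ?_
  exact le_of_opNorm_le _ ht _

theorem norm_toeplitz_le {φ : LInfSymbol E} {C : ℝ} (hC : 0 ≤ C)
    (h : ∀ᵐ t ∂arc, ‖φ.toFun t‖ ≤ C) : ‖toeplitz φ‖ ≤ C := by
  have h1 : ‖(hardyEmb (E := E)).toContinuousLinearMap‖ ≤ 1 :=
    (hardyEmb (E := E)).norm_toContinuousLinearMap_le
  have h2 : ‖adjoint (hardyEmb (E := E)).toContinuousLinearMap‖ ≤ 1 := by
    rwa [LinearIsometryEquiv.norm_map]
  calc ‖toeplitz φ‖ ≤ ‖adjoint (hardyEmb (E := E)).toContinuousLinearMap‖ *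
        (‖mulOp φ‖ * ‖(hardyEmb (E := E)).toContinuousLinearMap‖) :=
        (opNorm_comp_le _ _).trans (by gcongr; exact opNorm_comp_le _ _)
    _ ≤ 1 * (C * 1) := by gcongr; exact norm_mulOp_le hC h
    _ = C := by ring

theorem norm_quadToeplitz_le {a b c : E →L[ℂ] E} (h : circleSup (quadPoly a b c) ≤ 1) :
    ‖quadToeplitz a b c‖ ≤ 1 := by
  have hz (t : UnitAddCircle) : ‖quadPoly a b c (fourier 1 t)‖ ≤ 1 := by
    have h1 : (fourier 1 t : ℂ) ∈ Metric.sphere (0 : ℂ) 1 := by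
      rw [mem_sphere_zero_iff_norm]; exact norm_fourier_apply 1 t
    have h2 := (le_iSup₂ (f := fun z (_ : z ∈ Metric.sphere (0 : ℂ) 1) => ‖quadPoly a b c z‖ₑ)
      _ h1).trans h
    rwa [← ofReal_norm, ENNReal.ofReal_le_one] at h2
  rw [← toeplitz_quadPoly]
  refine norm_toeplitz_le zero_le_one (Filter.Eventually.of_forall hz)

/-- The truncated sequences `(z⁻ⁿ e)` are approximate eigenvectors: away from the ends the operator
acts on them as the symbol at `z` acts on `e`, and the ends become negligible as the length grows.
-/
theorem circleSup_le_of_norm_quadToeplitz_le {a b c : E →L[ℂ] E} (h : ‖quadToeplitz a b c‖ ≤ 1) :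
    circleSup (quadPoly a b c) ≤ 1 := by
  refine iSup₂_le fun z hz => ?_
  rw [mem_sphere_zero_iff_norm] at hz
  rw [← ofReal_norm, ENNReal.ofReal_le_one]
  refine opNorm_le_bound _ zero_le_one fun e => ?_
  rw [one_mul]
  have hz0 : z ≠ 0 := by rintro rfl; simp at hz
  set q := quadPoly a b c z e with hq
  -- With `N + 2` nonzero entries, the `N` output coordinates `2, …, N + 1` receive all three terms
  -- of the symbol.
  have key (N : ℕ) : (N : ℝ) * ‖q‖ ^ 2 ≤ (N + 2) * ‖e‖ ^ 2 := by
    let x : Ell2 E := ∑ n ∈ Finset.range (N + 2), sgl n (z⁻¹ ^ n • e)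
    have hx (n : ℕ) (hn : n < N + 2) : x n = z⁻¹ ^ n • e := by
      simp only [x, lp.coeFn_sum, Finset.sum_apply, sgl_apply_coe]
      rw [Finset.sum_ite_eq, if_pos (Finset.mem_range.mpr hn)]
    have hx' (n : ℕ) (hn : ¬ n < N + 2) : x n = 0 := by
      simp only [x, lp.coeFn_sum, Finset.sum_apply, sgl_apply_coe]
      rw [Finset.sum_ite_eq, if_neg (by simpa using hn)]
    have hnx : ‖x‖ ^ 2 = (N + 2) * ‖e‖ ^ 2 := by
      have h1 := lp.hasSum_norm (by norm_num) x
      have h2 := h1.unique (hasSum_sum_of_ne_finset_zero (s := Finset.range (N + 2))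
        fun n hn => by rw [hx' n (by simpa using hn)]; simp)
      rw [Finset.sum_congr rfl fun n hn => by rw [hx n (Finset.mem_range.mp hn)]] at h2
      simpa [norm_smul, hz] using h2
    have hT (n : ℕ) (hn : n < N) :
        quadToeplitz a b c x (n + 2) = z⁻¹ ^ (n + 2) • q := by
      change a (x (n + 2)) + b (shift E x (n + 2)) + c (shift E (shift E x) (n + 2)) = _
      rw [shift_apply_succ, shift_apply_succ, shift_apply_succ, hx _ (by omega), hx _ (by omega),
        hx _ (by omega), hq]
      simp only [quadPoly, map_smul, add_apply, smul_apply, smul_add, smul_smul]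
      have hw : z⁻¹ * z = 1 := inv_mul_cancel₀ hz0
      rw [show z⁻¹ ^ (n + 2) * z = z⁻¹ ^ (n + 1) by linear_combination z⁻¹ ^ (n + 1) * hw,
        show z⁻¹ ^ (n + 2) * z ^ 2 = z⁻¹ ^ n by linear_combination z⁻¹ ^ n * (z⁻¹ * z + 1) * hw]
    have h3 : ∑ n ∈ Finset.range N, ‖q‖ ^ 2 ≤ ‖quadToeplitz a b c x‖ ^ 2 := by
      have h4 := lp.sum_rpow_le_norm_rpow (by norm_num) (quadToeplitz a b c x)
        ((Finset.range N).map (addRightEmbedding 2))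
      rw [Finset.sum_map] at h4
      have h5 : ∀ n ∈ Finset.range N,
          ‖quadToeplitz a b c x (addRightEmbedding 2 n)‖ ^ (2 : ℝ≥0∞).toReal = ‖q‖ ^ 2 := by
        intro n hn
        rw [addRightEmbedding_apply, hT n (Finset.mem_range.mp hn)]
        simp [norm_smul, hz]
      rw [Finset.sum_congr rfl h5] at h4
      simpa using h4
    have h6 : ‖quadToeplitz a b c x‖ ≤ ‖x‖ := by
      simpa using (quadToeplitz a b c).le_of_opNorm_le h x
    rw [Finset.sum_const, Finset.card_range, nsmul_eq_mul] at h3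
    rw [← hnx]
    exact h3.trans (by gcongr)
  by_contra! hlt
  have hpos : 0 < ‖q‖ ^ 2 - ‖e‖ ^ 2 := by nlinarith [norm_nonneg e]
  obtain ⟨N, hN⟩ := exists_nat_gt (2 * ‖e‖ ^ 2 / (‖q‖ ^ 2 - ‖e‖ ^ 2))
  rw [div_lt_iff₀ hpos] at hN
  linarith [key N]

/-- On the circle `c* + b* z + a* z² = z² (a + b z + c z²)*`, so the two polynomials have equal
norms pointwise. -/
theorem circleSup_quadPoly_adjoint_le {a b c : E →L[ℂ] E} (h : circleSup (quadPoly a b c) ≤ 1) :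
    circleSup (quadPoly (c†) (b†) (a†)) ≤ 1 := by
  refine iSup₂_le fun z hz => le_trans (le_of_eq ?_)
    ((le_iSup₂ (f := fun z (_ : z ∈ Metric.sphere (0 : ℂ) 1) => ‖quadPoly a b c z‖ₑ) z hz).trans h)
  rw [mem_sphere_zero_iff_norm] at hz
  have hzz : z * conj z = 1 := by
    rw [Complex.mul_conj, Complex.normSq_eq_norm_sq, hz]; simp
  have h1 : quadPoly (c†) (b†) (a†) z = z ^ 2 • (quadPoly a b c z)† := by
    simp only [quadPoly, map_add, map_smulₛₗ, smul_add, smul_smul, map_pow]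
    rw [show z ^ 2 * conj z = z by linear_combination z * hzz,
      show z ^ 2 * conj z ^ 2 = 1 by linear_combination (z * conj z + 1) * hzz, one_smul]
    abel
  rw [h1, ← ofReal_norm, ← ofReal_norm, norm_smul, norm_pow, hz, one_pow, one_mul,
    LinearIsometryEquiv.norm_map]

end Toeplitz

/-! ### Matrix structure of Toeplitz operators -/

section ToeplitzAlgebra

variable {E : Type u} [NormedAddCommGroup E] [InnerProductSpace ℂ E] [CompleteSpace E]

/-- The entries of the operator matrix of `T` are constant along diagonals. -/
def IsToeplitz (T : Ell2 E →L[ℂ] Ell2 E) : Prop :=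
  ∀ i j e, T (sgl (j + 1) e) (i + 1) = T (sgl j e) i

theorem isToeplitz_toeplitz (φ : LInfSymbol E) : IsToeplitz (toeplitz φ) := fun i j e => by
  refine ext_inner_left ℂ fun e' => ?_
  rw [inner_toeplitz_sgl, inner_toeplitz_sgl]
  congr 1
  push_cast
  ring

omit [CompleteSpace E] in
theorem IsToeplitz.apply_add {T : Ell2 E →L[ℂ] Ell2 E} (hT : IsToeplitz T) (i j k : ℕ) (e : E) :
    T (sgl (j + k) e) (i + k) = T (sgl j e) i := by
  induction k with
  | zero => rfl
  | succ k ih => rw [← ih]; exact hT _ _ e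

theorem quadToeplitz_zero_zero_one : quadToeplitz (0 : E →L[ℂ] E) 0 1 = shift E * shift E := by
  refine ell2_clm_ext fun n e => ?_
  rw [quadToeplitz_sgl]
  change _ = shift E (shift E (sgl n e))
  rw [shift_sgl, shift_sgl]
  simp

theorem shift_mul_shift_sgl (n : ℕ) (e : E) : (shift E * shift E) (sgl n e) = sgl (n + 2) e := by
  change shift E (shift E (sgl n e)) = _
  rw [shift_sgl, shift_sgl]

/-- Toeplitz operators commuting with the square of the shift are lower triangular. -/
theorem IsToeplitz.apply_eq_zero_of_lt {T : Ell2 E →L[ℂ] Ell2 E} (hT : IsToeplitz T)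
    (hS : T * (shift E * shift E) = (shift E * shift E) * T) {i j : ℕ} (hij : i < j) (e : E) :
    T (sgl j e) i = 0 := by
  have h (n : ℕ) : T (sgl (n + 2) e) = shift E (shift E (T (sgl n e))) := by
    rw [← shift_mul_shift_sgl]
    exact congrArg (· (sgl n e)) hS
  obtain ⟨k, rfl⟩ := Nat.exists_eq_add_of_lt hij
  -- Columns from index 2 on lie in the range of the squared shift, so their coordinates 0 and 1
  -- vanish. A gap `j - i ≥ 2` is moved along the diagonal to row 0; a gap of 1 has to be moved to
  -- entry `(1, 2)`.
  obtain rfl | ⟨k, rfl⟩ : k = 0 ∨ ∃ l, k = l + 1 := by cases k <;> simp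
  · have h2 := hT.apply_add 0 1 i e
    rw [show i + 0 + 1 = 1 + i by ring]
    rw [zero_add] at h2
    rw [h2, ← hT 0 1 e, h 0, shift_apply_succ, shift_apply_zero]
  · have h2 := hT.apply_add 0 (k + 2) i e
    rw [show i + (k + 1) + 1 = (k + 2) + i by ring]
    rw [zero_add] at h2
    rw [h2, h k, shift_apply_zero]

/-- Both operators are lower triangular, while `T₁ = T₂* S²` with `T₂*` upper triangular has nothing
below the second subdiagonal; three constant diagonals remain. -/
theorem exists_eq_quadToeplitz {T₁ T₂ : Ell2 E →L[ℂ] Ell2 E} (h₁ : IsToeplitz T₁)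
    (h₂ : IsToeplitz T₂) (hS₁ : T₁ * (shift E * shift E) = (shift E * shift E) * T₁)
    (hS₂ : T₂ * (shift E * shift E) = (shift E * shift E) * T₂)
    (h : T₁ = star T₂ * (shift E * shift E)) : ∃ a b c, T₁ = quadToeplitz a b c := by
  let ev (n : ℕ) : E →L[ℂ] E := lp.evalCLM ℂ (fun _ : ℕ => E) 2 n ∘L T₁ ∘L sgl 0
  refine ⟨ev 0, ev 1, ev 2, ell2_clm_ext fun j e => ?_⟩
  rw [quadToeplitz_sgl]
  ext i
  rw [lp.coeFn_add, lp.coeFn_add, Pi.add_apply, Pi.add_apply, sgl_apply_coe, sgl_apply_coe,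
    sgl_apply_coe]
  change _ = (if i = j then T₁ (sgl 0 e) 0 else 0) + (if i = j + 1 then T₁ (sgl 0 e) 1 else 0) +
    (if i = j + 2 then T₁ (sgl 0 e) 2 else 0)
  rcases lt_or_ge i j with hij | hij
  · rw [h₁.apply_eq_zero_of_lt hS₁ hij, if_neg (by omega), if_neg (by omega), if_neg (by omega)]
    simp
  · obtain ⟨k, rfl⟩ := Nat.exists_eq_add_of_le hij
    have := h₁.apply_add k 0 j e
    rw [zero_add, add_comm k] at this
    rw [this]
    match k with
    | 0 => simp
    | 1 => simp
    | 2 => simp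
    | k + 3 =>
      rw [if_neg (by omega), if_neg (by omega), if_neg (by omega), add_zero, add_zero]
      refine ext_inner_left ℂ fun e' => ?_
      rw [← inner_sgl_left, h]
      change inner ℂ _ (star T₂ ((shift E * shift E) (sgl 0 e))) = _
      rw [shift_mul_shift_sgl, star_eq_adjoint, adjoint_inner_right, inner_sgl_right,
        h₂.apply_eq_zero_of_lt hS₂ (by omega), inner_zero_left, inner_zero_right]

/-- Operator form of the identity `z² (a + b z + c z²)* = c* + b* z + a* z²` on the circle. -/
theorem star_quadToeplitz_mul_shift_sq (a b c : E →L[ℂ] E) :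
    star (quadToeplitz a b c) * (shift E * shift E) = quadToeplitz (c†) (b†) (a†) := by
  refine ell2_clm_ext fun j e => ?_
  change star (quadToeplitz a b c) ((shift E * shift E) (sgl j e)) = _
  rw [shift_mul_shift_sgl]
  ext i
  refine ext_inner_left ℂ fun e' => ?_
  rw [← inner_sgl_left, star_eq_adjoint, adjoint_inner_right, inner_sgl_right, quadToeplitz_sgl,
    quadToeplitz_sgl]
  simp only [lp.coeFn_add, Pi.add_apply, sgl_apply_coe]
  by_cases h0 : j = i
  · subst h0; simp [adjoint_inner_right]
  by_cases h1 : i = j + 1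
  · subst h1; simp [adjoint_inner_right]
  by_cases h2 : i = j + 2
  · subst h2; simp [adjoint_inner_right]
  · rw [if_neg (by omega), if_neg (by omega), if_neg (by omega), if_neg (by omega),
      if_neg (by omega), if_neg (by omega)]
    simp

/-- Only coordinate 1 is needed, since `C₃` takes its values there; the `c†` term would land in
coordinate `-1` and is lost. -/
theorem adjoint_quadToeplitz_sgl_one (a b c : E →L[ℂ] E) (e : E) :
    ((quadToeplitz a b c)†) (sgl 1 e) = sgl 0 ((b†) e) + sgl 1 ((a†) e) := by
  ext i
  refine ext_inner_left ℂ fun e' => ?_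
  rw [← inner_sgl_left, adjoint_inner_right, inner_sgl_right, quadToeplitz_sgl]
  simp only [lp.coeFn_add, Pi.add_apply, sgl_apply_coe]
  match i with
  | 0 => simp [adjoint_inner_right]
  | 1 => simp [adjoint_inner_right]
  | i + 2 => simp

theorem quadToeplitz_mul_sgl (a b c a' b' c' : E →L[ℂ] E) (n : ℕ) (e : E) :
    (quadToeplitz a b c * quadToeplitz a' b' c') (sgl n e) =
      sgl n ((a * a') e) + sgl (n + 1) ((a * b' + b * a') e) +
        sgl (n + 2) ((a * c' + b * b' + c * a') e) + sgl (n + 3) ((b * c' + c * b') e) +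
          sgl (n + 4) ((c * c') e) := by
  change quadToeplitz a b c (quadToeplitz a' b' c' (sgl n e)) = _
  rw [quadToeplitz_sgl, map_add, map_add, quadToeplitz_sgl, quadToeplitz_sgl, quadToeplitz_sgl]
  simp only [add_apply, mul_def, comp_apply, map_add, Nat.add_assoc, Nat.reduceAdd]
  abel

theorem commute_quadToeplitz_iff {a b c a' b' c' : E →L[ℂ] E} :
    quadToeplitz a b c * quadToeplitz a' b' c' = quadToeplitz a' b' c' * quadToeplitz a b c ↔
      a * a' = a' * a ∧ a * b' + b * a' = a' * b + b' * a ∧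
        a * c' + b * b' + c * a' = a' * c + b' * b + c' * a ∧
          b * c' + c * b' = b' * c + c' * b ∧ c * c' = c' * c := by
  constructor
  · intro h
    have key (e : E) (i : ℕ) := congrArg (fun T : Ell2 E →L[ℂ] Ell2 E => T (sgl 0 e) i) h
    simp only [quadToeplitz_mul_sgl, lp.coeFn_add, Pi.add_apply, sgl_apply_coe] at key
    refine ⟨?_, ?_, ?_, ?_, ?_⟩ <;> ext e
    · simpa using key e 0
    · simpa using key e 1
    · simpa using key e 2
    · simpa using key e 3
    · simpa using key e 4
  · rintro ⟨h0, h1, h2, h3, h4⟩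
    refine ell2_clm_ext fun n e => ?_
    rw [quadToeplitz_mul_sgl, quadToeplitz_mul_sgl, h0, h1, h2, h3, h4]

end ToeplitzAlgebra

/-! ### Contractivity from hyponormality and slow growth -/

section Hyponormal

variable {K : Type u} [NormedAddCommGroup K] [InnerProductSpace ℂ K] [CompleteSpace K]

/-- The ratios `s (n + 1) / s n` do not decrease, so `s 0 < s 1` would force geometric growth,
against the linear bound. -/
theorem norm_le_of_log_convex {s : ℕ → ℝ} (hs : ∀ n, 0 ≤ s n)
    (hc : ∀ n, s (n + 1) ^ 2 ≤ s (n + 2) * s n) {α β : ℝ} (hg : ∀ n : ℕ, s n ≤ α + n * β) :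
    s 1 ≤ s 0 := by
  by_contra! hlt
  have h0 : 0 < s 0 := by
    rcases (hs 0).eq_or_lt with h | h
    · have := hc 0
      rw [← h, mul_zero] at this
      nlinarith [hs 0]
    · exact h
  set r := s 1 / s 0 with hr
  have hr1 : 1 < r := (one_lt_div h0).mpr hlt
  have hstep (n : ℕ) : 0 < s n ∧ r * s n ≤ s (n + 1) := by
    induction n with
    | zero => exact ⟨h0, by rw [hr, div_mul_cancel₀ _ h0.ne']⟩
    | succ n ih =>
      have hpos : 0 < s (n + 1) := lt_of_lt_of_le (mul_pos (by linarith) ih.1) ih.2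
      refine ⟨hpos, ?_⟩
      have : r * s (n + 1) * s n ≤ s (n + 2) * s n := by
        nlinarith [hc n, mul_le_mul_of_nonneg_right ih.2 hpos.le]
      exact le_of_mul_le_mul_right this ih.1
  have hpow (n : ℕ) : r ^ n * s 0 ≤ s n := by
    induction n with
    | zero => simp
    | succ n ih =>
      rw [pow_succ']
      nlinarith [(hstep n).2]
  have hb (n : ℕ) : s 0 ≤ α * (n ^ 0 / r ^ n) + β * (n ^ 1 / r ^ n) := by
    have hrn : 0 < r ^ n := by positivity
    have := (hpow n).trans (hg n)
    rw [pow_zero, pow_one, mul_div_assoc', mul_div_assoc', ← add_div, le_div_iff₀ hrn]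
    linarith
  have ht := ((tendsto_pow_const_div_const_pow_of_one_lt 0 hr1).const_mul α).add
    ((tendsto_pow_const_div_const_pow_of_one_lt 1 hr1).const_mul β)
  rw [mul_zero, mul_zero, add_zero] at ht
  exact absurd (ge_of_tendsto' ht hb) (not_le.mpr h0)

/-- If `X = Y* V` and `Y = X* V` with `V` isometric and `X`, `Y` commuting, then `X` is hyponormal,
so `X` is a contraction as soon as its powers grow at most linearly. -/
theorem norm_le_one_of_linear_growth {X Y V : K →L[ℂ] K} (hV : star V * V = 1)
    (hXY : X * Y = Y * X) (hX : X = star Y * V) (hY : Y = star X * V) {M : ℝ}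
    (hg : ∀ (n : ℕ) y, ‖(X ^ n) y‖ ≤ (2 + n * M) * ‖y‖) : ‖X‖ ≤ 1 := by
  have hXX : star X * X = star Y * Y := by
    calc star X * X = star X * star Y * V := by rw [mul_assoc, ← hX]
      _ = star Y * star X * V := by rw [← star_mul, ← star_mul, hXY]
      _ = star Y * Y := by rw [mul_assoc, ← hY]
  have hn (y : K) : ‖X y‖ = ‖Y y‖ := by
    rw [← sq_eq_sq₀ (norm_nonneg _) (norm_nonneg _), X.apply_norm_sq_eq_inner_adjoint_left,
      Y.apply_norm_sq_eq_inner_adjoint_left]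
    exact congrArg (fun T : K →L[ℂ] K => RCLike.re (inner ℂ (T y) y)) hXX
  have hsV (y : K) : ‖star V y‖ ≤ ‖y‖ := by
    refine (le_opNorm _ _).trans (mul_le_of_le_one_left (norm_nonneg _) ?_)
    rw [norm_star]
    exact opNorm_le_bound _ zero_le_one fun x => by rw [norm_isometry_apply hV, one_mul]
  -- Hyponormality: `X* = V* Y` with `V*` contractive, and `‖Y y‖ = ‖X y‖` because `X* X = X* Y* V =
  -- Y* X* V = Y* Y`. It makes `n ↦ ‖Xⁿ y‖` log-convex.
  have hhyp (y : K) : ‖star X y‖ ≤ ‖X y‖ := by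
    have : star X = star V * Y := by
      conv_lhs => rw [hX, star_mul, star_star]
    rw [this, hn]
    exact hsV (Y y)
  have hsq (y : K) : ‖X y‖ ^ 2 ≤ ‖X (X y)‖ * ‖y‖ := by
    rw [X.apply_norm_sq_eq_inner_adjoint_left]
    refine (re_inner_le_norm _ _).trans ?_
    gcongr
    exact hhyp (X y)
  refine opNorm_le_bound _ zero_le_one fun y => ?_
  rw [one_mul]
  refine norm_le_of_log_convex (s := fun n => ‖(X ^ n) y‖) (fun n => norm_nonneg _) (fun n => ?_)
    (α := 2 * ‖y‖) (β := M * ‖y‖) fun n => (hg n y).trans_eq (by ring)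
  have e1 : (X ^ (n + 1)) y = X ((X ^ n) y) := by rw [pow_succ']; rfl
  have e2 : (X ^ (n + 2)) y = X (X ((X ^ n) y)) := by rw [pow_succ', pow_succ']; rfl
  simp only [e1, e2]
  exact hsq _

end Hyponormal

/-! ### Lower triangular block operators -/

section Block

variable {H G : Type u} [NormedAddCommGroup H] [InnerProductSpace ℂ H]
  [NormedAddCommGroup G] [InnerProductSpace ℂ G]

theorem lowerTri_apply (A : H →L[ℂ] H) (C : H →L[ℂ] G) (T : G →L[ℂ] G) (h : H) (x : G) :
    lowerTri A C T (WithLp.toLp 2 (h, x)) = WithLp.toLp 2 (A h, C h + T x) := rfl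

theorem lowerTri_mul (A A' : H →L[ℂ] H) (C C' : H →L[ℂ] G) (T T' : G →L[ℂ] G) :
    lowerTri A C T * lowerTri A' C' T' = lowerTri (A * A') (C ∘L A' + T ∘L C') (T * T') := by
  ext1 y
  obtain ⟨h, x⟩ := y
  change lowerTri A C T (lowerTri A' C' T' (WithLp.toLp 2 (h, x))) = _
  rw [lowerTri_apply, lowerTri_apply, lowerTri_apply]
  simp only [mul_def, comp_apply, add_apply, map_add, add_assoc]

theorem lowerTri_inj {A A' : H →L[ℂ] H} {C C' : H →L[ℂ] G} {T T' : G →L[ℂ] G} :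
    lowerTri A C T = lowerTri A' C' T' ↔ A = A' ∧ C = C' ∧ T = T' := by
  constructor
  · intro h
    have key (a : H) (x : G) : A a = A' a ∧ C a + T x = C' a + T' x := by
      have := congrArg (· (WithLp.toLp 2 (a, x))) h
      simp only [lowerTri_apply] at this
      exact Prod.mk.inj (WithLp.toLp_injective 2 this)
    refine ⟨ContinuousLinearMap.ext fun a => (key a 0).1,
      ContinuousLinearMap.ext fun a => by simpa using (key a 0).2,
      ContinuousLinearMap.ext fun x => by simpa using (key 0 x).2⟩
  · rintro ⟨rfl, rfl, rfl⟩
    rfl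

variable [CompleteSpace H] [CompleteSpace G]

theorem adjoint_lowerTri_inl (A : H →L[ℂ] H) (C : H →L[ℂ] G) (T : G →L[ℂ] G) (h : H) :
    ((lowerTri A C T)†) (inlIsometry h) = inlIsometry ((A†) h) := by
  refine ext_inner_left ℂ fun y => ?_
  obtain ⟨k, x⟩ := y
  rw [adjoint_inner_right, lowerTri_apply]
  change inner ℂ _ (WithLp.toLp 2 (h, (0 : G))) = inner ℂ _ (WithLp.toLp 2 ((A†) h, (0 : G)))
  rw [WithLp.prod_inner_apply, WithLp.prod_inner_apply]
  change inner ℂ (A k) h + inner ℂ _ 0 = inner ℂ k ((A†) h) + inner ℂ x 0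
  rw [inner_zero_right, inner_zero_right, adjoint_inner_right]

theorem star_lowerTri_mul_eq_iff {A B P : H →L[ℂ] H} {C₁ C₂ C₃ : H →L[ℂ] G}
    {T₁ T₂ T₃ : G →L[ℂ] G} :
    lowerTri A C₁ T₁ = star (lowerTri B C₂ T₂) * lowerTri P C₃ T₃ ↔
      A = B† ∘L P + C₂† ∘L C₃ ∧ C₂† ∘L T₃ = 0 ∧ C₁ = T₂† ∘L C₃ ∧ T₁ = T₂† ∘L T₃ := by
  have key (h k : H) (x y : G) : inner ℂ (WithLp.toLp 2 (k, y))
        ((star (lowerTri B C₂ T₂) * lowerTri P C₃ T₃) (WithLp.toLp 2 (h, x))) =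
      inner ℂ (WithLp.toLp 2 (k, y)) (WithLp.toLp 2
        ((B† ∘L P + C₂† ∘L C₃) h + (C₂† ∘L T₃) x, (T₂† ∘L C₃) h + (T₂† ∘L T₃) x)) := by
    change inner ℂ _ (star (lowerTri B C₂ T₂) (lowerTri P C₃ T₃ (WithLp.toLp 2 (h, x)))) = _
    rw [star_eq_adjoint, adjoint_inner_right, lowerTri_apply, lowerTri_apply,
      WithLp.prod_inner_apply, WithLp.prod_inner_apply]
    simp only [inner_add_left, inner_add_right, comp_apply, add_apply, adjoint_inner_right]
    ring
  have key' (h : H) (x : G) : (star (lowerTri B C₂ T₂) * lowerTri P C₃ T₃) (WithLp.toLp 2 (h, x)) =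
      WithLp.toLp 2
        ((B† ∘L P + C₂† ∘L C₃) h + (C₂† ∘L T₃) x, (T₂† ∘L C₃) h + (T₂† ∘L T₃) x) :=
    ext_inner_left ℂ fun z => key h z.fst x z.snd
  constructor
  · intro e
    have key2 (h : H) (x : G) : A h = (B† ∘L P + C₂† ∘L C₃) h + (C₂† ∘L T₃) x ∧
        C₁ h + T₁ x = (T₂† ∘L C₃) h + (T₂† ∘L T₃) x := by
      have := key' h x
      rw [← e, lowerTri_apply] at this
      exact Prod.mk.inj (WithLp.toLp_injective 2 this)
    refine ⟨ContinuousLinearMap.ext fun h => ?_, ContinuousLinearMap.ext fun x => ?_,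
      ContinuousLinearMap.ext fun h => ?_, ContinuousLinearMap.ext fun x => ?_⟩
    · simpa using (key2 h 0).1
    · simpa using (key2 0 x).1.symm
    · simpa using (key2 h 0).2
    · simpa using (key2 0 x).2
  · rintro ⟨h1, h2, h3, h4⟩
    ext1 y
    obtain ⟨h, x⟩ := y
    rw [key', ← h1, h2, ← h3, ← h4, zero_apply, add_zero]
    rfl

-- The diagonal entries of the `n`-th power are contractions, which accounts for the 2; the corner
-- is a sum of `n` terms, each of norm at most `‖C‖`.
omit [CompleteSpace H] [CompleteSpace G] in
theorem norm_lowerTri_pow_le {A : H →L[ℂ] H} {C : H →L[ℂ] G} {T : G →L[ℂ] G} (hA : ‖A‖ ≤ 1)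
    (hT : ‖T‖ ≤ 1) (n : ℕ) (y : WithLp 2 (H × G)) :
    ‖(lowerTri A C T ^ n) y‖ ≤ (2 + n * ‖C‖) * ‖y‖ := by
  have hf : ‖y.fst‖ ≤ ‖y‖ := by
    rw [← sq_le_sq₀ (norm_nonneg _) (norm_nonneg _), WithLp.prod_norm_sq_eq_of_L2]
    nlinarith [sq_nonneg ‖y.snd‖]
  have hs : ‖y.snd‖ ≤ ‖y‖ := by
    rw [← sq_le_sq₀ (norm_nonneg _) (norm_nonneg _), WithLp.prod_norm_sq_eq_of_L2]
    nlinarith [sq_nonneg ‖y.fst‖]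
  have key : ‖((lowerTri A C T ^ n) y).fst‖ ≤ ‖y‖ ∧
      ‖((lowerTri A C T ^ n) y).snd‖ ≤ (1 + n * ‖C‖) * ‖y‖ := by
    induction n with
    | zero => simpa using ⟨hf, hs⟩
    | succ n ih =>
      rw [pow_succ']
      set w := (lowerTri A C T ^ n) y
      change ‖A w.fst‖ ≤ _ ∧ ‖C w.fst + T w.snd‖ ≤ _
      refine ⟨?_, ?_⟩
      · exact (le_of_opNorm_le A hA _).trans (by rw [one_mul]; exact ih.1)
      · calc ‖C w.fst + T w.snd‖ ≤ ‖C‖ * ‖w.fst‖ + 1 * ‖w.snd‖ :=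
              (norm_add_le _ _).trans (add_le_add (le_opNorm _ _) (le_of_opNorm_le T hT _))
          _ ≤ ‖C‖ * ‖y‖ + 1 * ((1 + n * ‖C‖) * ‖y‖) := by gcongr; exacts [ih.1, ih.2]
          _ = _ := by push_cast; ring
  set w := (lowerTri A C T ^ n) y
  have : ‖w‖ ≤ ‖w.fst‖ + ‖w.snd‖ := by
    rw [← sq_le_sq₀ (norm_nonneg _) (by positivity), WithLp.prod_norm_sq_eq_of_L2]
    nlinarith [norm_nonneg w.fst, norm_nonneg w.snd]
  linarith [key.1, key.2]

end Block

/-! ### Columns and the isometry `V₃` -/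

section Dilation

variable {H E : Type u} [NormedAddCommGroup H] [InnerProductSpace ℂ H] [CompleteSpace H]
  [NormedAddCommGroup E] [InnerProductSpace ℂ E] [CompleteSpace E]

omit [CompleteSpace H] [CompleteSpace E] in
theorem column_apply (X Y : H →L[ℂ] E) (h : H) : column X Y h = sgl 0 (X h) + sgl 1 (Y h) := rfl

theorem adjoint_column_sgl_one (X Y : H →L[ℂ] E) (e : E) :
    ((column X Y)†) (sgl 1 e) = (Y†) e := by
  refine ext_inner_left ℂ fun h => ?_
  rw [adjoint_inner_right, inner_sgl_right, column_apply, adjoint_inner_right, lp.coeFn_add,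
    Pi.add_apply, sgl_apply_coe, sgl_apply_coe]
  simp

theorem adjoint_column_sgl_add_two (X Y : H →L[ℂ] E) (n : ℕ) (e : E) :
    ((column X Y)†) (sgl (n + 2) e) = 0 := by
  refine ext_inner_left ℂ fun h => ?_
  rw [adjoint_inner_right, inner_sgl_right, column_apply, lp.coeFn_add, Pi.add_apply,
    sgl_apply_coe, sgl_apply_coe]
  simp

omit [CompleteSpace H] in
theorem adjoint_quadToeplitz_column (a b c : E →L[ℂ] E) (D : H →L[ℂ] E) :
    (quadToeplitz a b c)† ∘L column 0 D = column (b† ∘L D) (a† ∘L D) := by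
  ext1 h
  change ((quadToeplitz a b c)†) (column 0 D h) = _
  rw [column_apply, column_apply, zero_apply, map_zero, zero_add, adjoint_quadToeplitz_sgl_one]
  rfl

/-- `D* D` supplies exactly the defect of `P`, and the column, living in coordinate 1, is orthogonal
to the range of the squared shift. -/
theorem star_lowerTri_mul_self_of_defect {P : H →L[ℂ] H} {D : H →L[ℂ] E} (hD : D† ∘L D = 1 - P† ∘L P) :
    star (lowerTri P (column 0 D) (shift E * shift E)) *
      lowerTri P (column 0 D) (shift E * shift E) = 1 := by
  have h1 : (1 : WithLp 2 (H × Ell2 E) →L[ℂ] WithLp 2 (H × Ell2 E)) = lowerTri 1 0 1 := by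
    ext1 y
    obtain ⟨h, x⟩ := y
    rw [lowerTri_apply]
    simp
  have hss : adjoint (shift E * shift E) = bshift E * bshift E := by
    rw [← star_eq_adjoint, star_mul]; rfl
  rw [h1, eq_comm, star_lowerTri_mul_eq_iff]
  refine ⟨?_, ?_, ?_, ?_⟩
  · rw [show (column (0 : H →L[ℂ] E) D)† ∘L column 0 D = D† ∘L D from ?_, hD]
    · abel
    · ext1 h
      change ((column (0 : H →L[ℂ] E) D)†) (column 0 D h) = _
      rw [column_apply, zero_apply, map_zero, zero_add, adjoint_column_sgl_one]
      rfl
  · refine ell2_clm_ext fun n e => ?_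
    change ((column (0 : H →L[ℂ] E) D)†) ((shift E * shift E) (sgl n e)) = 0
    rw [shift_mul_shift_sgl, adjoint_column_sgl_add_two]
  · ext1 h
    rw [hss]
    change 0 = bshift E (bshift E (column 0 D h))
    rw [column_apply, zero_apply, map_zero, zero_add, ← zero_add 1, ← shift_sgl, bshift_shift,
      bshift_sgl_zero]
  · ext1 x
    rw [hss]
    change x = bshift E (bshift E (shift E (shift E x)))
    rw [bshift_shift, bshift_shift]

end Dilation

/-! ### Fundamental operators and the two implications -/

section Dilation

variable {H E : Type u} [NormedAddCommGroup H] [InnerProductSpace ℂ H] [CompleteSpace H]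
  [NormedAddCommGroup E] [InnerProductSpace ℂ E] [CompleteSpace E]

theorem adjoint_injective_of_denseRange {D : H →L[ℂ] E} (hd : DenseRange D) :
    Function.Injective (D†) := by
  rw [injective_iff_map_eq_zero]
  intro e he
  have h0 : (fun x => inner ℂ e x) = fun _ => (0 : ℂ) :=
    hd.equalizer (by fun_prop) (by fun_prop) <| funext fun h => by
      simp only [Function.comp_apply]
      rw [← adjoint_inner_left, he, inner_zero_left]
  exact inner_self_eq_zero.mp (congrFun h0 e)

theorem eq_of_sandwich_eq {D : H →L[ℂ] E} (hd : DenseRange D) {F F' : E →L[ℂ] E}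
    (h : ∀ x, (D†) (F (D x)) = (D†) (F' (D x))) : F = F' :=
  DFunLike.coe_injective <| hd.equalizer F.continuous F'.continuous <|
    funext fun x => adjoint_injective_of_denseRange hd (h x)

/-- `D A = F₁ D + F₂* D P` for the fundamental operators. -/
theorem defect_comp_eq {A B P : H →L[ℂ] H} {D : H →L[ℂ] E} (hd : DenseRange D)
    (hD : D† ∘L D = 1 - P† ∘L P) (hAP : A * P = P * A) {F₁ F₂ : E →L[ℂ] E}
    (h₁ : A - B† ∘L P = D† ∘L F₁ ∘L D) (h₂ : B - A† ∘L P = D† ∘L F₂ ∘L D) (x : H) :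
    D (A x) = F₁ (D x) + (F₂†) (D (P x)) := by
  -- After applying `D*` the sum telescopes: `(A - B* P) + (B* P - P* A P) = A - P* P A`, the second
  -- bracket being the adjoint of the equation for `F₂` evaluated at `P x`.
  apply adjoint_injective_of_denseRange hd
  have e2 := congrArg star h₂
  have e2' : B† - P† ∘L A = D† ∘L F₂† ∘L D := by
    simpa [star_eq_adjoint, adjoint_comp, adjoint_adjoint, comp_assoc] using e2
  have a1 : (D†) (D (A x)) = A x - (P†) (P (A x)) := congrArg (· (A x)) hD
  have a2 : A x - (B†) (P x) = (D†) (F₁ (D x)) := congrArg (· x) h₁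
  have a3 : (B†) (P x) - (P†) (A (P x)) = (D†) ((F₂†) (D (P x))) := congrArg (· (P x)) e2'
  have a4 : A (P x) = P (A x) := congrArg (· x) hAP
  rw [map_add, a1, ← a2, ← a3, a4]
  abel

theorem adjoint_column_comp_column_zero (X Y : H →L[ℂ] E) (D : H →L[ℂ] E) :
    (column X Y)† ∘L column 0 D = Y† ∘L D := by
  ext1 h
  change ((column X Y)†) (column 0 D h) = _
  rw [column_apply, zero_apply, map_zero, zero_add, adjoint_column_sgl_one]
  rfl

theorem adjoint_column_comp_shift_sq (X Y : H →L[ℂ] E) :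
    (column X Y)† ∘L (shift E * shift E) = 0 :=
  ell2_clm_ext fun n e => by
    change ((column X Y)†) ((shift E * shift E) (sgl n e)) = 0
    rw [shift_mul_shift_sgl, adjoint_column_sgl_add_two]

theorem quadToeplitz_mul_shift_sq (a b c : E →L[ℂ] E) :
    quadToeplitz a b c * (shift E * shift E) = (shift E * shift E) * quadToeplitz a b c := by
  rw [← quadToeplitz_zero_zero_one, commute_quadToeplitz_iff]
  simp

/-- The algebraic conditions on `Ξ` under which `F₁ + Ξ z + F₂* z²` and `F₂ + Ξ* z + F₁* z²`
commute. -/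
theorem commute_quadToeplitz_fundamental {F₁ F₂ Ξ : E →L[ℂ] E}
    (hz2 : ⁅F₂, F₂†⁆ - ⁅F₁, F₁†⁆ = ⁅Ξ, Ξ†⁆) (hz0 : ⁅F₁, F₂⁆ = 0) (hz1 : ⁅Ξ, F₂⁆ = ⁅Ξ†, F₁⁆) :
    quadToeplitz F₁ Ξ (F₂†) * quadToeplitz F₂ (Ξ†) (F₁†) =
      quadToeplitz F₂ (Ξ†) (F₁†) * quadToeplitz F₁ Ξ (F₂†) := by
  simp only [Ring.lie_def] at hz0 hz1 hz2
  have E0 : F₁ * F₂ = F₂ * F₁ := sub_eq_zero.mp hz0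
  have E1 : F₁ * Ξ† + Ξ * F₂ = F₂ * Ξ + Ξ† * F₁ := by
    linear_combination (norm := abel) hz1
  refine commute_quadToeplitz_iff.mpr ⟨E0, E1, ?_, ?_, ?_⟩
  · linear_combination (norm := abel) -hz2
  -- The coefficients of `z³` and `z⁴` are the adjoints of those of `z` and `1`.
  · have := congrArg star E1
    simp only [star_add, star_mul, star_eq_adjoint, adjoint_adjoint] at this
    linear_combination (norm := abel) this
  · have := congrArg star E0
    simp only [star_mul, star_eq_adjoint] at this
    exact this

theorem exists_of_isTetrablockIsometry {A B P : H →L[ℂ] H} {D : H →L[ℂ] E} (hd : DenseRange D)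
    (hD : D† ∘L D = 1 - P† ∘L P) (hAP : A * P = P * A) (hBP : B * P = P * B) {F₁ F₂ : E →L[ℂ] E}
    (h₁ : A - B† ∘L P = D† ∘L F₁ ∘L D) (h₂ : B - A† ∘L P = D† ∘L F₂ ∘L D)
    {C₁ C₂ : H →L[ℂ] Ell2 E} {T₁ T₂ : Ell2 E →L[ℂ] Ell2 E} (hT₁ : IsToeplitz T₁)
    (hT₂ : IsToeplitz T₂)
    (hiso : IsTetrablockIsometry ![lowerTri A C₁ T₁, lowerTri B C₂ T₂,
        lowerTri P (column 0 D) (shift E * shift E)]) :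
      ∃ Ξ : E →L[ℂ] E, T₁ = quadToeplitz F₁ Ξ (F₂†) ∧ T₂ = quadToeplitz F₂ (Ξ†) (F₁†) ∧
        C₁ = column (Ξ ∘L D) (F₂† ∘L D) ∧ C₂ = column (Ξ† ∘L D) (F₁† ∘L D) ∧
        (Ξ * F₁† - Ξ† * F₂†) ∘L D ∘L P = 0 ∧
        ⁅F₂, F₂†⁆ - ⁅F₁, F₁†⁆ = ⁅Ξ, Ξ†⁆ ∧ ⁅F₁, F₂⁆ = 0 ∧ ⁅Ξ, F₂⁆ = ⁅Ξ†, F₁⁆ ∧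
        Ξ ∘L D ∘L P = 0 ∧ Ξ† ∘L D ∘L P = 0 ∧ circleSup (quadPoly F₁ Ξ (F₂†)) ≤ 1 := by
  have hDA := defect_comp_eq hd hD hAP h₁ h₂
  have hDB := defect_comp_eq hd hD hBP h₂ h₁
  have hcc := fun X Y : H →L[ℂ] E => adjoint_column_comp_column_zero X Y D
  have hadj (a b c : E →L[ℂ] E) :
      ((quadToeplitz a b c)†) ∘L (shift E * shift E) = quadToeplitz (c†) (b†) (a†) :=
    star_quadToeplitz_mul_shift_sq a b c
  have hC₃ (h : H) : column (0 : H →L[ℂ] E) D h = sgl 1 (D h) := by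
    rw [column_apply, zero_apply, map_zero, zero_add]
  obtain ⟨hC, -, hV0, hV1, hn, -⟩ := hiso.relations
  replace hV0 : lowerTri A C₁ T₁ = star (lowerTri B C₂ T₂) *
    lowerTri P (column 0 D) (shift E * shift E) := hV0
  replace hV1 : lowerTri B C₂ T₂ = star (lowerTri A C₁ T₁) *
    lowerTri P (column 0 D) (shift E * shift E) := hV1
  replace hn : ‖lowerTri A C₁ T₁‖ ≤ 1 := hn
  have c01 : lowerTri A C₁ T₁ * lowerTri B C₂ T₂ = lowerTri B C₂ T₂ * lowerTri A C₁ T₁ := hC 0 1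
  have c02 : lowerTri A C₁ T₁ * lowerTri P (column 0 D) (shift E * shift E) =
    lowerTri P (column 0 D) (shift E * shift E) * lowerTri A C₁ T₁ := hC 0 2
  have c12 : lowerTri B C₂ T₂ * lowerTri P (column 0 D) (shift E * shift E) =
    lowerTri P (column 0 D) (shift E * shift E) * lowerTri B C₂ T₂ := hC 1 2
  rw [lowerTri_mul, lowerTri_mul, lowerTri_inj] at c01 c02 c12
  rw [star_lowerTri_mul_eq_iff] at hV0 hV1
  obtain ⟨-, e01, t01⟩ := c01
  obtain ⟨-, e02, t02⟩ := c02
  obtain ⟨-, e12, t12⟩ := c12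
  obtain ⟨p0, -, q0, r0⟩ := hV0
  obtain ⟨p1, -, q1, r1⟩ := hV1
  obtain ⟨a, b, c, rfl⟩ := exists_eq_quadToeplitz hT₁ hT₂ t02 t12 r0
  rw [hadj] at r1
  subst r1
  rw [adjoint_quadToeplitz_column, adjoint_adjoint, adjoint_adjoint] at q0
  rw [adjoint_quadToeplitz_column] at q1
  subst q0 q1
  rw [hcc, adjoint_comp, adjoint_adjoint] at p0
  rw [hcc, adjoint_comp] at p1
  -- The corner blocks of `V₁ = V₂* V₃` and `V₂ = V₁* V₃` say that `a` and `c†` solve the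
  -- fundamental equations, whose solutions are unique.
  have ha : a = F₁ := eq_of_sandwich_eq hd fun x => by
    have := congrArg (· x) h₁
    rw [show A - B† ∘L P = (D† ∘L a) ∘L D by rw [sub_eq_iff_eq_add']; exact p0] at this
    exact this
  have hc : c† = F₂ := eq_of_sandwich_eq hd fun x => by
    have := congrArg (· x) h₂
    rw [show B - A† ∘L P = (D† ∘L c†) ∘L D by rw [sub_eq_iff_eq_add']; exact p1] at this
    exact this
  have hc' : c = F₂† := by rw [← hc, adjoint_adjoint]
  subst ha hc'
  rw [adjoint_adjoint] at t01 e01 e12 t12 hT₂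
  -- Coordinate 0 of the corner of `V₁ V₃ = V₃ V₁`: all terms except `b D P` start in coordinate 1
  -- or later.
  have x0 (h : H) : b (D (P h)) = 0 := by
    have := congrArg (fun X : H →L[ℂ] Ell2 E => X h 0) e02
    simpa [hC₃, quadToeplitz_sgl, column_apply, sgl_apply_coe, shift_apply_zero, mul_def,
      -lp.singleContinuousLinearMap_apply] using this
  have x1 (h : H) : (b†) (D (P h)) = 0 := by
    have := congrArg (fun X : H →L[ℂ] Ell2 E => X h 0) e12
    simpa [hC₃, quadToeplitz_sgl, column_apply, sgl_apply_coe, shift_apply_zero, mul_def,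
      -lp.singleContinuousLinearMap_apply] using this
  obtain ⟨E0, E1, E2, -, -⟩ := commute_quadToeplitz_iff.mp t01
  refine ⟨b, rfl, by rw [adjoint_adjoint], rfl, rfl, ?_, ?_, ?_, ?_, ?_, ?_, ?_⟩
  · ext1 h
    -- Coordinate 0 of the corner of `V₁ V₂ = V₂ V₁` reads `b D B + a b* D = b* D A + F₂ b D`;
    -- expanding `D A` and `D B` and subtracting the `z` coefficient `E1` leaves the terms in `D P`.
    have k := congrArg (fun X : H →L[ℂ] Ell2 E => X h 0) e01
    simp [quadToeplitz_sgl, column_apply, sgl_apply_coe, -lp.singleContinuousLinearMap_apply] at k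
    have k1 := congrArg (· (D h)) E1
    simp [mul_def] at k1
    rw [hDA, hDB, map_add, map_add] at k
    change b ((a†) (D (P h))) - (b†) ((F₂†) (D (P h))) = 0
    linear_combination (norm := abel) k - k1
  · simp only [Ring.lie_def]
    linear_combination (norm := abel) -E2
  · rw [Ring.lie_def, E0, sub_self]
  · simp only [Ring.lie_def]
    linear_combination (norm := abel) E1
  · exact ContinuousLinearMap.ext x0
  · exact ContinuousLinearMap.ext x1
  -- The Toeplitz corner is the restriction of the contraction `V₁` to `0 ⊕ ℓ²(E)`.
  · refine circleSup_le_of_norm_quadToeplitz_le (opNorm_le_bound _ zero_le_one fun x => ?_)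
    have := le_of_opNorm_le _ hn (WithLp.toLp 2 ((0 : H), x))
    rw [lowerTri_apply, map_zero, map_zero, zero_add] at this
    simpa using this

theorem isTetrablockIsometry_of_fundamental {A B P : H →L[ℂ] H} {D : H →L[ℂ] E} (hd : DenseRange D)
    (hD : D† ∘L D = 1 - P† ∘L P) (hAB : A * B = B * A) (hAP : A * P = P * A) (hBP : B * P = P * B)
    (hB : ‖B‖ ≤ 1) {F₁ F₂ : E →L[ℂ] E}
    (h₁ : A - B† ∘L P = D† ∘L F₁ ∘L D) (h₂ : B - A† ∘L P = D† ∘L F₂ ∘L D)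
    {Ξ : E →L[ℂ] E} (hx : (Ξ * F₁† - Ξ† * F₂†) ∘L D ∘L P = 0)
    (hz2 : ⁅F₂, F₂†⁆ - ⁅F₁, F₁†⁆ = ⁅Ξ, Ξ†⁆) (hz0 : ⁅F₁, F₂⁆ = 0) (hz1 : ⁅Ξ, F₂⁆ = ⁅Ξ†, F₁⁆)
    (hx0 : Ξ ∘L D ∘L P = 0) (hx1 : Ξ† ∘L D ∘L P = 0)
    (hs : circleSup (quadPoly F₁ Ξ (F₂†)) ≤ 1) :
    IsTetrablockIsometry ![lowerTri A (column (Ξ ∘L D) (F₂† ∘L D)) (quadToeplitz F₁ Ξ (F₂†)),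
      lowerTri B (column (Ξ† ∘L D) (F₁† ∘L D)) (quadToeplitz F₂ (Ξ†) (F₁†)),
      lowerTri P (column 0 D) (shift E * shift E)] := by
  have hDA := defect_comp_eq hd hD hAP h₁ h₂
  have hDB := defect_comp_eq hd hD hBP h₂ h₁
  have hx0' (h : H) : Ξ (D (P h)) = 0 := congrArg (· h) hx0
  have hx1' (h : H) : (Ξ†) (D (P h)) = 0 := congrArg (· h) hx1
  have hx' (h : H) : Ξ ((F₁†) (D (P h))) - (Ξ†) ((F₂†) (D (P h))) = 0 := congrArg (· h) hx
  have hcomm := commute_quadToeplitz_fundamental hz2 hz0 hz1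
  have hV := star_lowerTri_mul_self_of_defect hD
  set T₁ := quadToeplitz F₁ Ξ (F₂†) with hT₁
  set T₂ := quadToeplitz F₂ (Ξ†) (F₁†) with hT₂
  set C₁ := column (Ξ ∘L D) (F₂† ∘L D) with hC₁
  set C₂ := column (Ξ† ∘L D) (F₁† ∘L D) with hC₂
  set S := shift E * shift E with hS
  have c01 : lowerTri A C₁ T₁ * lowerTri B C₂ T₂ = lowerTri B C₂ T₂ * lowerTri A C₁ T₁ := by
    rw [lowerTri_mul, lowerTri_mul, lowerTri_inj]
    refine ⟨hAB, ?_, hcomm⟩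
    obtain ⟨-, E1, E2, E3, E4⟩ := commute_quadToeplitz_iff.mp hcomm
    ext1 h
    -- The corner identity is checked coordinatewise with the coefficient equations `E1`–`E4`.
    -- Expanding `D A` and `D B` leaves `D P` terms in coordinate 0, settled by `hx'`, and in
    -- coordinate 1, settled by `E4` at `D P h`.
    have k1 := congrArg (fun X : E →L[ℂ] E => sgl 0 (X (D h))) E1
    have k2 := congrArg (fun X : E →L[ℂ] E => sgl 1 (X (D h))) E2
    have k3 := congrArg (fun X : E →L[ℂ] E => sgl 2 (X (D h))) E3
    have k4 := congrArg (fun X : E →L[ℂ] E => sgl 3 (X (D h))) E4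
    have k0 := congrArg (fun X : E →L[ℂ] E => sgl 1 (X (D (P h)))) E4
    have k5 := congrArg (sgl 0) (hx' h)
    simp only [add_apply, mul_def, comp_apply, map_add, map_sub, map_zero] at k0 k1 k2 k3 k4 k5
    simp only [hC₁, hC₂, hT₁, hT₂, add_apply, comp_apply, column_apply, map_add, quadToeplitz_sgl,
      hDA, hDB, Nat.reduceAdd]
    linear_combination (norm := abel) k0 + k1 + k2 + k3 + k4 + k5
  have c02 : lowerTri A C₁ T₁ * lowerTri P (column 0 D) S =
      lowerTri P (column 0 D) S * lowerTri A C₁ T₁ := by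
    rw [lowerTri_mul, lowerTri_mul, lowerTri_inj]
    refine ⟨hAP, ?_, quadToeplitz_mul_shift_sq _ _ _⟩
    ext1 h
    simp only [hC₁, hT₁, hS, add_apply, comp_apply, column_apply, map_add, quadToeplitz_sgl, hDA,
      hx0', shift_mul_shift_sgl, map_zero, zero_apply, Nat.reduceAdd]
    abel
  have c12 : lowerTri B C₂ T₂ * lowerTri P (column 0 D) S =
      lowerTri P (column 0 D) S * lowerTri B C₂ T₂ := by
    rw [lowerTri_mul, lowerTri_mul, lowerTri_inj]
    refine ⟨hBP, ?_, quadToeplitz_mul_shift_sq _ _ _⟩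
    ext1 h
    simp only [hC₂, hT₂, hS, add_apply, comp_apply, column_apply, map_add, quadToeplitz_sgl, hDB,
      hx1', shift_mul_shift_sgl, map_zero, zero_apply, Nat.reduceAdd]
    abel
  have r0 : lowerTri A C₁ T₁ = star (lowerTri B C₂ T₂) * lowerTri P (column 0 D) S := by
    refine star_lowerTri_mul_eq_iff.mpr ⟨?_, adjoint_column_comp_shift_sq _ _, ?_, ?_⟩
    · rw [hC₂, adjoint_column_comp_column_zero, adjoint_comp, adjoint_adjoint]
      exact sub_eq_iff_eq_add'.mp h₁
    · rw [hT₂, adjoint_quadToeplitz_column, adjoint_adjoint]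
    · have := star_quadToeplitz_mul_shift_sq F₂ (Ξ†) (F₁†)
      rw [adjoint_adjoint, adjoint_adjoint] at this
      exact this.symm
  have r1 : lowerTri B C₂ T₂ = star (lowerTri A C₁ T₁) * lowerTri P (column 0 D) S := by
    refine star_lowerTri_mul_eq_iff.mpr ⟨?_, adjoint_column_comp_shift_sq _ _, ?_, ?_⟩
    · rw [hC₁, adjoint_column_comp_column_zero, adjoint_comp, adjoint_adjoint]
      exact sub_eq_iff_eq_add'.mp h₂
    · rw [hT₁, adjoint_quadToeplitz_column]
    · have := star_quadToeplitz_mul_shift_sq F₁ Ξ (F₂†)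
      rw [adjoint_adjoint] at this
      exact this.symm
  refine isTetrablockIsometry_of_relations ?_ hV r0 ?_
  · intro i j
    fin_cases i <;> fin_cases j
    exacts [rfl, c01, c02, c01.symm, rfl, c12, c02.symm, c12.symm, rfl]
  -- Only the diagonal blocks `B` and `T₂` of `V₂` are known to be contractions; linear growth of
  -- the powers then yields contractivity of the whole.
  · have hs' : ‖quadToeplitz F₂ (Ξ†) (F₁†)‖ ≤ 1 := by
      have := circleSup_quadPoly_adjoint_le hs
      rw [adjoint_adjoint] at this
      exact norm_quadToeplitz_le this
    exact norm_le_one_of_linear_growth hV c01.symm r1 r0 (norm_lowerTri_pow_le hB hs')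

end Dilation

/-! ### Tetrablock contractions and the defect operator -/

section Contraction

theorem norm_le_one_of_mem_closedTetrablock {z : Fin 3 → ℂ} (hz : z ∈ closedTetrablock) (i : Fin 3) :
    ‖z i‖ ≤ 1 := by
  obtain ⟨M, hM, rfl⟩ := hz
  have hcol (j : Fin 2) : ‖M 0 j‖ ^ 2 + ‖M 1 j‖ ^ 2 ≤ 1 := by
    have h1 : ‖Matrix.toEuclideanCLM (𝕜 := ℂ) M (EuclideanSpace.single j 1)‖ ≤ 1 := by
      simpa using le_of_opNorm_le (Matrix.toEuclideanCLM (𝕜 := ℂ) M) hM (EuclideanSpace.single j 1)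
    have h2 : ‖Matrix.toEuclideanCLM (𝕜 := ℂ) M (EuclideanSpace.single j 1)‖ ^ 2 ≤ 1 :=
      pow_le_one₀ (norm_nonneg _) h1
    rw [EuclideanSpace.norm_sq_eq] at h2
    simpa [Matrix.ofLp_toEuclideanCLM] using h2
  have h0 := hcol 0
  have h1 := hcol 1
  fin_cases i
  · change ‖M 0 0‖ ≤ 1
    nlinarith [norm_nonneg (M 0 0), sq_nonneg ‖M 1 0‖]
  · change ‖M 1 1‖ ≤ 1
    nlinarith [norm_nonneg (M 1 1), sq_nonneg ‖M 0 1‖]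
  · change ‖M.det‖ ≤ 1
    rw [Matrix.det_fin_two]
    refine (norm_sub_le _ _).trans ?_
    rw [norm_mul, norm_mul]
    -- `|det M| ≤ |m₁₁ m₂₂| + |m₁₂ m₂₁|` is at most half the sum of the squared entries, which is at
    -- most 2 by the column bounds.
    nlinarith [sq_nonneg (‖M 0 0‖ - ‖M 1 1‖), sq_nonneg (‖M 0 1‖ - ‖M 1 0‖)]

variable {H : Type u} [NormedAddCommGroup H] [InnerProductSpace ℂ H]

theorem polyEval_one (T : Fin 3 → H →L[ℂ] H) : polyEval T 1 = 1 := by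
  simp [polyEval, MvPolynomial.support_one]

theorem polyEval_X (T : Fin 3 → H →L[ℂ] H) (i : Fin 3) : polyEval T (MvPolynomial.X i) = T i := by
  rw [polyEval, MvPolynomial.support_X, Finset.sum_singleton]
  fin_cases i <;> simp [MvPolynomial.coeff_X]

/-- The coordinate functions are bounded by 1 on the closed tetrablock. These bounds and
commutativity are all that the main theorem takes from the spectral set hypothesis. -/
theorem IsSpectralSet.norm_le_one {T : Fin 3 → H →L[ℂ] H}
    (hT : IsSpectralSet closedTetrablock T) (i : Fin 3) : ‖T i‖ ≤ 1 := by
  have h := hT.2.2 (MvPolynomial.X i) 1 (fun z _ => by simp)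
  rw [polyEval_one, polyEval_X, Ring.inverse_one, mul_one] at h
  have h2 : ‖T i‖ₑ ≤ 1 := h.trans <| iSup₂_le fun z hz => by
    rw [MvPolynomial.eval_X, map_one, div_one, ← ofReal_norm, ENNReal.ofReal_le_one]
    exact norm_le_one_of_mem_closedTetrablock hz i
  rwa [← ofReal_norm, ENNReal.ofReal_le_one] at h2

variable [CompleteSpace H]

theorem denseRange_defectTo (P : H →L[ℂ] H) : DenseRange (defectTo P) := fun y => by
  rw [Topology.IsInducing.subtypeVal.closure_eq_preimage_closure_image, Set.mem_preimage,
    ← Set.range_comp]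
  exact y.2

theorem adjoint_defectTo_apply (P : H →L[ℂ] H) (e : defectSpace P) :
    ((defectTo P)†) e = defectOp P e := by
  have hsa : IsSelfAdjoint (defectOp P) := (CFC.sqrt_nonneg _).isSelfAdjoint
  refine ext_inner_left ℂ fun x => ?_
  rw [adjoint_inner_right, ← hsa.adjoint_eq, adjoint_inner_right]
  rfl

theorem adjoint_defectTo_comp_self {P : H →L[ℂ] H} (hP : ‖P‖ ≤ 1) :
    (defectTo P)† ∘L defectTo P = 1 - P† ∘L P := by
  have hpos : 0 ≤ 1 - P† * P := by
    rw [sub_nonneg, ← star_eq_adjoint]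
    refine (CStarAlgebra.norm_le_one_iff_of_nonneg _ (star_mul_self_nonneg P)).mp ?_
    rw [CStarRing.norm_star_mul_self]
    exact mul_le_one₀ hP (norm_nonneg _) hP
  ext1 x
  change ((defectTo P)†) (defectTo P x) = _
  rw [adjoint_defectTo_apply]
  exact congrArg (· x) (CFC.sqrt_mul_sqrt_self _ hpos)

end Contraction

end Tetrablock

end

open Tetrablock ContinuousLinearMap in
open scoped InnerProduct in
theorem theorem4p1 {H : Type*} [NormedAddCommGroup H] [InnerProductSpace ℂ H] [CompleteSpace H]
    (A B P : H →L[ℂ] H) (hT : IsTetrablockContraction A B P)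
    (F₁ F₂ : defectSpace P →L[ℂ] defectSpace P) (hF : IsFundamentalPair A B P F₁ F₂)
    (C₁ C₂ : H →L[ℂ] Ell2 (defectSpace P)) (φ₁ φ₂ : LInfSymbol (defectSpace P)) :
    (IsTetrablockIsometricDilation inlIsometry A B P
        (lowerTri A C₁ (toeplitz φ₁)) (lowerTri B C₂ (toeplitz φ₂))
        (lowerTri P (column 0 (defectTo P)) (toeplitz zSq)) ↔
      ∃ Ξ : defectSpace P →L[ℂ] defectSpace P,
        φ₁.Represents (quadPoly F₁ Ξ (F₂†)) ∧
        φ₂.Represents (quadPoly F₂ (Ξ†) (F₁†)) ∧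
        C₁ = column (Ξ ∘L defectTo P) (F₂† ∘L defectTo P) ∧
        C₂ = column (Ξ† ∘L defectTo P) (F₁† ∘L defectTo P) ∧
        (Ξ * F₁† - Ξ† * F₂†) ∘L defectTo P ∘L P = 0 ∧
        ⁅F₂, F₂†⁆ - ⁅F₁, F₁†⁆ = ⁅Ξ, Ξ†⁆ ∧
        ⁅F₁, F₂⁆ = 0 ∧
        ⁅Ξ, F₂⁆ = ⁅Ξ†, F₁⁆ ∧
        Ξ ∘L defectTo P ∘L P = 0 ∧ Ξ† ∘L defectTo P ∘L P = 0 ∧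
        circleSup (quadPoly F₁ Ξ (F₂†)) ≤ 1) ∧
    (∀ Ξ : defectSpace P →L[ℂ] defectSpace P,
      circleSup (quadPoly F₁ Ξ (F₂†)) ≤ 1 ↔ circleSup (quadPoly F₂ (Ξ†) (F₁†)) ≤ 1) := by
  obtain ⟨hC, -, -⟩ := id hT
  have hAB : A * B = B * A := hC 0 1
  have hAP : A * P = P * A := hC 0 2
  have hBP : B * P = P * B := hC 1 2
  have hB : ‖B‖ ≤ 1 := IsSpectralSet.norm_le_one hT 1
  have hd := denseRange_defectTo P
  have hD := adjoint_defectTo_comp_self (IsSpectralSet.norm_le_one hT 2 : ‖P‖ ≤ 1)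
  have h₁ : A - B† ∘L P = (defectTo P)† ∘L F₁ ∘L defectTo P :=
    ContinuousLinearMap.ext fun x =>
      (hF.1 x).trans (adjoint_defectTo_apply P (F₁ (defectTo P x))).symm
  have h₂ : B - A† ∘L P = (defectTo P)† ∘L F₂ ∘L defectTo P :=
    ContinuousLinearMap.ext fun x =>
      (hF.2 x).trans (adjoint_defectTo_apply P (F₂ (defectTo P x))).symm
  refine ⟨?_, fun Ξ => ⟨fun h => ?_, fun h => ?_⟩⟩
  -- A symbol is determined by its Toeplitz operator, so both sides become statements about
  -- operators on `ℓ²(𝒟_P)`.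
  · simp only [represents_quadPoly_iff]
    rw [toeplitz_zSq, quadToeplitz_zero_zero_one]
    constructor
    · rintro ⟨hiso, -⟩
      exact exists_of_isTetrablockIsometry hd hD hAP hBP h₁ h₂ (isToeplitz_toeplitz φ₁)
        (isToeplitz_toeplitz φ₂) hiso
    · rintro ⟨Ξ, hT₁, hT₂, rfl, rfl, hx, hz2, hz0, hz1, hx0, hx1, hs⟩
      rw [hT₁, hT₂]
      exact ⟨isTetrablockIsometry_of_fundamental hd hD hAB hAP hBP hB h₁ h₂ hx hz2 hz0 hz1 hx0 hx1
        hs, fun x => ⟨adjoint_lowerTri_inl _ _ _ x, adjoint_lowerTri_inl _ _ _ x,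
          adjoint_lowerTri_inl _ _ _ x⟩⟩
  · simpa only [adjoint_adjoint] using circleSup_quadPoly_adjoint_le h
  · simpa only [adjoint_adjoint] using circleSup_quadPoly_adjoint_le h
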